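/- Let $\mathbb D$ be the open unit disc and $\mathbb T$ the unit circle with normalized Lebesgue measure $m$. Let $H^2$ be the Hardy space of the disc, identified via radial limits with the closed subspace $\{f\in L^2(\mathbb T):\widehat f(n)=0\text{ for all } n<0\}$ of $L^2(\mathbb T)$, the holomorphic function on $\mathbb D$ belonging to $f$ being $f(z)=\sum_{n\ge 0}\widehat f(n)z^n$. For $\lambda\in\mathbb D$ let $k_\lambda(z)=\dfrac{1}{1-\overline{\lambda}z}$. A function $f\in H^2$ is called outer if $\log|f|\in L^1(\mathbb T)$ and there is a constant $c$ with $|c|=1$ such that \[ f(z)=c\,\exp\left(\int_{\mathbb T}\frac{\zeta+z}{\zeta-z}\,\log|f(\zeta)|\,dm(\zeta)\right),\qquad z\in\mathbb D . \] Let $(\lambda_n)_{n\ge 1}$ be a sequence in $\mathbb D$ whose distinct terms do not satisfy the Blaschke condition, that is, \[ \sum_{\lambda\in\{\lambda_n:\,n\ge1\}}(1-|\lambda|)=\infty \] (for pairwise distinct $\lambda_n$ this says $\sum_{n\ge1}(1-|\lambda_n|)=\infty$), and let $f\in H^2$. Then the closed linear span in $H^2$ of the family $\{f k_{\lambda_n}:n\ge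 1\}$ is equal to $H^2$ if and only if $f$ is outer. -/

import Mathlib

open MeasureTheory AddCircle Complex
open scoped ENNReal ComplexConjugate

noncomputable section

/-- The Hilbert space `L²(𝕋)`. The unit circle `𝕋` with its normalized Lebesgue measure `m` is
parametrized by `ℝ / ℤ` with its Haar probability measure, through `x ↦ ζ = exp (2 π i x)`
(`AddCircle.toCircle`). -/
abbrev L2Circle : Type := Lp ℂ 2 (haarAddCircle : Measure UnitAddCircle)

/-- The Hardy space `H²`, as the subspace of all `f` in `L²(𝕋)` whose Fourier coefficients
`∫ f(ζ) ζ⁻ⁿ dm(ζ)` with negative index `n` vanish. -/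
def hardySpace : Submodule ℂ L2Circle where
  carrier := {f | ∀ n : ℤ, n < 0 → fourierCoeff f n = 0}
  zero_mem' := by
    intro n _
    rw [← fourierBasis_repr]
    simp
  add_mem' := by
    intro f g hf hg n hn
    have h1 := hf n hn
    have h2 := hg n hn
    rw [← fourierBasis_repr] at *
    simp [h1, h2]
  smul_mem' := by
    intro c f hf n hn
    have h1 := hf n hn
    rw [← fourierBasis_repr] at *
    simp [h1]

/-- The holomorphic function on the unit disc whose boundary function is `f ∈ H²`:
`f(z) = ∑ n ≥ 0, f̂(n) zⁿ`. -/
def diskValue (f : L2Circle) (z : UnitDisc) : ℂ :=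
  ∑' n : ℕ, fourierCoeff f (n : ℤ) * (z : ℂ) ^ n

/-- The Cauchy kernel `k_w(z) = 1 / (1 - w̄ z)`. -/
def cauchyKernel (w : UnitDisc) (z : ℂ) : ℂ := 1 / (1 - conj (w : ℂ) * z)

theorem one_sub_conj_mul_ne_zero (w : UnitDisc) (x : UnitAddCircle) :
    1 - conj (w : ℂ) * (toCircle x : ℂ) ≠ 0 := by
  intro h
  have h1 : ‖conj (w : ℂ) * (toCircle x : ℂ)‖ = 1 := by
    rw [← sub_eq_zero.mp h, norm_one]
  rw [norm_mul, RCLike.norm_conj, Circle.norm_coe, mul_one] at h1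
  exact absurd h1 w.norm_lt_one.ne

theorem continuous_cauchyKernel (w : UnitDisc) :
    Continuous fun x : UnitAddCircle => cauchyKernel w (toCircle x) := by
  unfold cauchyKernel
  refine continuous_const.div ?_ (one_sub_conj_mul_ne_zero w)
  exact continuous_const.sub
    (continuous_const.mul (continuous_subtype_val.comp AddCircle.continuous_toCircle))

theorem memLp_mul_cauchyKernel (f : L2Circle) (w : UnitDisc) :
    MemLp (fun x : UnitAddCircle => f x * cauchyKernel w (toCircle x)) 2 haarAddCircle := by
  have hk : MemLp (fun x : UnitAddCircle => cauchyKernel w (toCircle x)) ∞ haarAddCircle := by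
    obtain ⟨C, hC⟩ := (isCompact_range (continuous_cauchyKernel w)).isBounded.exists_norm_le
    exact memLp_top_of_bound (continuous_cauchyKernel w).aestronglyMeasurable C
      (Filter.Eventually.of_forall fun x => hC _ ⟨x, rfl⟩)
  exact hk.mul (Lp.memLp f)

/-- The product `f k_w`. -/
def mulCauchyKernel (f : L2Circle) (w : UnitDisc) : L2Circle :=
  (memLp_mul_cauchyKernel f w).toLp

/-- `f ∈ H²` is outer: `log |f|` is integrable on `𝕋` (in particular `f ≠ 0` almost everywhere;
this is listed separately because `Real.log 0 = 0`), and for a constant `c` of modulus one,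
`f(z) = c exp (∫ (ζ + z) / (ζ - z) log |f(ζ)| dm(ζ))` on the unit disc. -/
def IsOuter (f : L2Circle) : Prop :=
  f ∈ hardySpace ∧
  (∀ᵐ x ∂(haarAddCircle : Measure UnitAddCircle), f x ≠ 0) ∧
  Integrable (fun x => Real.log ‖f x‖) (haarAddCircle : Measure UnitAddCircle) ∧
  ∃ c : ℂ, ‖c‖ = 1 ∧ ∀ z : UnitDisc,
    diskValue f z = c * Complex.exp
      (∫ x : UnitAddCircle,
        ((toCircle x : ℂ) + (z : ℂ)) / ((toCircle x : ℂ) - (z : ℂ)) * (Real.log ‖f x‖ : ℂ)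
        ∂haarAddCircle)

end

open Filter Topology

noncomputable section

/-! Necessity. A zero of `f` in the disc would be a common zero of all `f k_w`, hence of the closed
span, which contains `1`; so `f` has no zeros. If `p f` is close to `1` in L², with `p` a
combination of kernels, Jensen's inequality for `p` gives log|p(0)| + ∫ log|f| ≤ ∫ log|p f| ≤ ‖p f -
1‖, while p(0) f(0) is close to `1`. In the limit ∫ log|f| ≤ log|f(0)|, which is equality in
Jensen's inequality (`jensen_hardySpace`). For zero-free `f` this equality forces log|f(rζ)| →
log|f(ζ)| in L¹, so the Schwarz integral formula for a logarithm of f(r·) passes to the limit r → 1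
and becomes the outer representation (`isOuter_of_integral_log_eq`).

Sufficiency. Let `g` be orthogonal to all f k_λ. The Cauchy transform of the integrable function
`conj g * f` vanishes at the conjugates of the λ. It is dominated by a zero-free holomorphic
function, so by Jensen's formula its zeros satisfy the Blaschke condition unless it vanishes
identically (`integral_mul_fourier_eq_zero`). Hence `g` is orthogonal to every zⁿ f, and it remains
to see that an outer `f` is cyclic for the shift. As in Beurling's theorem, the component `v` of `f`
orthogonal to z f, z² f, … has constant modulus, and f · conj v / |v|² lies in H² with value `1` at
the origin. Jensen's inequality for this quotient, compared with |f(0)| = exp ∫ log|f|, forces `v`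
to be a nonzero constant (`eq_smul_fourierLp_of_isOuter`). So all monomials lie in the closed span.
-/

theorem HasSum.congr_eq {α β : Type*} [AddCommMonoid α] [TopologicalSpace α] {f g : β → α} {a : α}
    (hf : HasSum f a) (h : ∀ b, g b = f b) : HasSum g a :=
  funext h ▸ hf

/-! ### Multiplication operators and Fourier coefficients on L²(𝕋) -/

/-- Multiplication of `L²(𝕋)` by continuous functions. -/
def mulC : C(UnitAddCircle, ℂ) →L[ℂ] L2Circle →L[ℂ] L2Circle :=
  ((ContinuousLinearMap.mul ℂ ℂ).holderL haarAddCircle ∞ 2 2).comp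
    (ContinuousMap.toLp ∞ haarAddCircle ℂ)

theorem coeFn_mulC (p : C(UnitAddCircle, ℂ)) (f : L2Circle) :
    mulC p f =ᵐ[haarAddCircle] fun x => p x * f x := by
  have h := (ContinuousLinearMap.mul ℂ ℂ).coeFn_holder (r := 2)
    (ContinuousMap.toLp (E := ℂ) ∞ haarAddCircle ℂ p) f
  filter_upwards [h, ContinuousMap.coeFn_toLp (p := ∞) (𝕜 := ℂ) haarAddCircle p] with x hx hp
  change (ContinuousLinearMap.mul ℂ ℂ).holder (r := 2)
    (ContinuousMap.toLp (E := ℂ) ∞ haarAddCircle ℂ p) f x = _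
  rw [hx, hp]
  rfl

theorem mulC_mul (p q : C(UnitAddCircle, ℂ)) (f : L2Circle) :
    mulC (p * q) f = mulC p (mulC q f) := by
  apply Lp.ext
  filter_upwards [coeFn_mulC (p * q) f, coeFn_mulC p (mulC q f), coeFn_mulC q f] with x h1 h2 h3
  rw [h1, h2, h3, ContinuousMap.mul_apply, mul_assoc]

theorem mulC_one (f : L2Circle) : mulC 1 f = f := by
  apply Lp.ext
  filter_upwards [coeFn_mulC 1 f] with x h1
  rw [h1, ContinuousMap.one_apply, one_mul]

theorem fourier_zero_eq_one : (fourier 0 : C(UnitAddCircle, ℂ)) = 1 := by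
  ext x
  simp

theorem fourier_mul_fourier (m n : ℤ) :
    (fourier m : C(UnitAddCircle, ℂ)) * fourier n = fourier (m + n) := by
  ext x
  simp only [ContinuousMap.mul_apply, fourier_add]

theorem mulC_fourier_fourier (m n : ℤ) (f : L2Circle) :
    mulC (fourier m) (mulC (fourier n) f) = mulC (fourier (m + n)) f := by
  rw [← mulC_mul, fourier_mul_fourier]

theorem mulC_fourier_zero (f : L2Circle) : mulC (fourier 0) f = f := by
  rw [fourier_zero_eq_one, mulC_one]

theorem inner_eq_integral (f g : L2Circle) :
    inner ℂ f g = ∫ x, conj (f x) * g x ∂haarAddCircle := by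
  rw [L2.inner_def]
  refine integral_congr_ae (Filter.Eventually.of_forall fun x => ?_)
  simp [mul_comm]

theorem integrable_conj_mul (f g : L2Circle) :
    Integrable (fun x => conj (f x) * g x) (haarAddCircle : Measure UnitAddCircle) := by
  have h := L2.integrable_inner (𝕜 := ℂ) f g
  refine h.congr (Filter.Eventually.of_forall fun x => ?_)
  simp [mul_comm]

theorem fourierCoeff_eq_inner (f : L2Circle) (n : ℤ) :
    fourierCoeff f n = inner ℂ (fourierLp 2 n) f := by
  rw [← fourierBasis_repr, HilbertBasis.repr_apply_apply, coe_fourierBasis]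

theorem inner_mulC_fourier (n : ℤ) (f g : L2Circle) :
    inner ℂ (mulC (fourier n) f) g = inner ℂ f (mulC (fourier (-n)) g) := by
  rw [inner_eq_integral, inner_eq_integral]
  refine integral_congr_ae ?_
  filter_upwards [coeFn_mulC (fourier n) f, coeFn_mulC (fourier (-n)) g] with x h1 h2
  rw [h1, h2, fourier_neg, map_mul]
  ring

theorem mulC_fourier_fourierLp (m n : ℤ) :
    mulC (fourier m) (fourierLp 2 n) = fourierLp 2 (m + n) := by
  apply Lp.ext
  filter_upwards [coeFn_mulC (fourier m) (fourierLp 2 n), coeFn_fourierLp (T := 1) 2 n,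
    coeFn_fourierLp (T := 1) 2 (m + n)] with x h1 h2 h3
  rw [h1, h2, h3, fourier_add]

theorem fourierCoeff_mulC_fourier (m n : ℤ) (f : L2Circle) :
    fourierCoeff (mulC (fourier m) f) n = fourierCoeff f (n - m) := by
  rw [fourierCoeff_eq_inner, fourierCoeff_eq_inner, ← neg_neg m, ← inner_mulC_fourier,
    mulC_fourier_fourierLp]
  congr 2
  ring

theorem mem_hardySpace_iff (f : L2Circle) :
    f ∈ hardySpace ↔ ∀ n : ℤ, n < 0 → fourierCoeff f n = 0 := Iff.rfl

theorem isClosed_hardySpace : IsClosed (hardySpace : Set L2Circle) := by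
  have h : (hardySpace : Set L2Circle) =
      ⋂ (n : ℤ) (_ : n < 0), {f | inner ℂ (fourierLp 2 n) f = 0} := by
    ext f
    simp [mem_hardySpace_iff, fourierCoeff_eq_inner]
  rw [h]
  exact isClosed_iInter fun n => isClosed_iInter fun _ =>
    isClosed_eq (continuous_const.inner continuous_id) continuous_const

theorem mulC_fourier_mem_hardySpace {f : L2Circle} (hf : f ∈ hardySpace) (n : ℕ) :
    mulC (fourier n) f ∈ hardySpace := by
  intro m hm
  rw [fourierCoeff_mulC_fourier]
  exact hf _ (by omega)

theorem norm_fourierLp_two (n : ℤ) : ‖(fourierLp 2 n : L2Circle)‖ = 1 :=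
  orthonormal_fourier.norm_eq_one n

theorem fourierCoeff_fourierLp (m n : ℤ) :
    fourierCoeff (fourierLp 2 m : L2Circle) n = if n = m then 1 else 0 := by
  rw [fourierCoeff_eq_inner]
  exact orthonormal_iff_ite.mp orthonormal_fourier n m

theorem fourierLp_mem_hardySpace (n : ℕ) : (fourierLp 2 (n : ℤ) : L2Circle) ∈ hardySpace := by
  intro m hm
  rw [fourierCoeff_fourierLp, if_neg (by omega)]

theorem hasSum_fourier_of_mem_hardySpace {f : L2Circle} (hf : f ∈ hardySpace) :
    HasSum (fun n : ℕ => fourierCoeff f (n : ℤ) • (fourierLp 2 (n : ℤ) : L2Circle)) f := by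
  have h := hasSum_fourier_series_L2 f
  refine (Function.Injective.hasSum_iff (g := ((↑) : ℕ → ℤ)) Nat.cast_injective ?_).mpr h
  intro m hm
  have : m < 0 := by
    by_contra h0
    exact hm ⟨m.toNat, by simp; omega⟩
  simp [hf m this]

/-! ### Cauchy kernels and point evaluations -/

/-- The Cauchy kernel as a continuous function on the circle. -/
def kern (w : UnitDisc) : C(UnitAddCircle, ℂ) := ⟨_, continuous_cauchyKernel w⟩

theorem mulCauchyKernel_eq (f : L2Circle) (w : UnitDisc) :
    mulCauchyKernel f w = mulC (kern w) f := by
  apply Lp.ext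
  filter_upwards [coeFn_mulC (kern w) f, (memLp_mul_cauchyKernel f w).coeFn_toLp] with x h1 h2
  rw [h1]
  exact h2.trans (mul_comm _ _)

theorem norm_fourier_one (n : ℤ) : ‖(fourier n : C(UnitAddCircle, ℂ))‖ = 1 := fourier_norm n

/-- The geometric series converges in the supremum norm, so continuity of `mulC` carries facts about
monomials over to kernels. -/
theorem hasSum_kern (w : UnitDisc) :
    HasSum (fun n : ℕ => conj (w : ℂ) ^ n • (fourier (n : ℤ) : C(UnitAddCircle, ℂ))) (kern w) := by
  have hs : Summable fun n : ℕ => conj (w : ℂ) ^ n • (fourier (n : ℤ) : C(UnitAddCircle, ℂ)) := by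
    refine Summable.of_norm ?_
    simp only [norm_smul, norm_pow, norm_fourier_one, mul_one, RCLike.norm_conj]
    exact summable_geometric_of_lt_one (norm_nonneg _) w.norm_lt_one
  have h := hs.hasSum
  convert h
  ext x
  have h2 := ContinuousMap.hasSum_apply h x
  refine HasSum.unique ?_ h2
  have h3 := hasSum_geometric_of_norm_lt_one (ξ := conj (w : ℂ) * (toCircle x : ℂ))
    (by simpa [Circle.norm_coe] using w.norm_lt_one)
  have e : kern w x = (1 - conj (w : ℂ) * (toCircle x : ℂ))⁻¹ := one_div _
  rw [e]
  refine h3.congr_eq fun n => ?_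
  simp [mul_pow, fourier_apply, toCircle_nsmul]

theorem hasSum_mulC_kern (w : UnitDisc) (f : L2Circle) :
    HasSum (fun n : ℕ => conj (w : ℂ) ^ n • mulC (fourier (n : ℤ)) f) (mulC (kern w) f) := by
  have h := (hasSum_kern w).mapL (ContinuousLinearMap.flip mulC f)
  simpa using h

theorem mulC_kern_mem_hardySpace {f : L2Circle} (hf : f ∈ hardySpace) (w : UnitDisc) :
    mulC (kern w) f ∈ hardySpace :=
  isClosed_hardySpace.mem_of_tendsto (hasSum_mulC_kern w f)
    (Filter.Eventually.of_forall fun _ => hardySpace.sum_mem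
      fun n _ => hardySpace.smul_mem _ (mulC_fourier_mem_hardySpace hf n))

/-- Reproducing property of the kernel: evaluation at `z` becomes a continuous linear functional on
all of L²(𝕋). -/
theorem hasSum_diskValue (f : L2Circle) (z : UnitDisc) :
    HasSum (fun n : ℕ => fourierCoeff f (n : ℤ) * (z : ℂ) ^ n)
      (inner ℂ (mulC (kern z) (fourierLp 2 0)) f) := by
  have h := (hasSum_mulC_kern z (fourierLp 2 0)).mapL (innerSL ℂ f)
  have h2 := h.star
  simp only [mulC_fourier_fourierLp, add_zero, map_smul, smul_eq_mul, innerSL_apply_apply,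
    star_mul', star_pow, RCLike.star_def, conj_conj, inner_conj_symm] at h2
  refine h2.congr_eq fun n => ?_
  rw [fourierCoeff_eq_inner, mul_comm]

theorem diskValue_eq_inner (f : L2Circle) (z : UnitDisc) :
    diskValue f z = inner ℂ (mulC (kern z) (fourierLp 2 0)) f :=
  (hasSum_diskValue f z).tsum_eq

theorem diskValue_add (f g : L2Circle) (z : UnitDisc) :
    diskValue (f + g) z = diskValue f z + diskValue g z := by
  simp [diskValue_eq_inner, inner_add_right]

theorem diskValue_smul (c : ℂ) (f : L2Circle) (z : UnitDisc) :
    diskValue (c • f) z = c * diskValue f z := by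
  simp [diskValue_eq_inner, inner_smul_right]

theorem diskValue_zero (f : L2Circle) : diskValue f 0 = fourierCoeff f 0 := by
  unfold diskValue
  rw [tsum_eq_single 0]
  · simp
  · intro n hn
    simp [hn]

theorem diskValue_fourierLp_zero (z : UnitDisc) :
    diskValue (fourierLp 2 0 : L2Circle) z = 1 := by
  unfold diskValue
  simp only [fourierCoeff_fourierLp]
  rw [tsum_eq_single 0]
  · simp
  · intro n hn
    simp [hn]

theorem diskValue_mulC_fourier {f : L2Circle} (hf : f ∈ hardySpace) (n : ℕ) (z : UnitDisc) :
    diskValue (mulC (fourier n) f) z = (z : ℂ) ^ n * diskValue f z := by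
  have h1 := (hasSum_diskValue (mulC (fourier n) f) z)
  rw [← diskValue_eq_inner] at h1
  have h2 := (hasSum_diskValue f z).mul_left ((z : ℂ) ^ n)
  rw [← diskValue_eq_inner] at h2
  refine h1.unique ?_
  refine (Function.Injective.hasSum_iff (g := fun m : ℕ => m + n) (add_left_injective n) ?_).mp ?_
  · intro m hm
    have : m < n := by
      by_contra h0
      exact hm ⟨m - n, by simp; omega⟩
    rw [fourierCoeff_mulC_fourier, hf _ (by omega), zero_mul]
  · refine h2.congr_eq fun m => ?_
    simp only [Function.comp_apply, fourierCoeff_mulC_fourier, Nat.cast_add, add_sub_cancel_right]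
    ring

theorem diskValue_mulC_kern {f : L2Circle} (hf : f ∈ hardySpace) (w z : UnitDisc) :
    diskValue (mulC (kern w) f) z = cauchyKernel w z * diskValue f z := by
  have h := (hasSum_mulC_kern w f).mapL
    (innerSL ℂ (mulC (kern z) (fourierLp 2 0)))
  simp only [map_smul, innerSL_apply_apply, ← diskValue_eq_inner, diskValue_mulC_fourier hf] at h
  refine h.unique ?_
  have h3 := (hasSum_geometric_of_norm_lt_one (ξ := conj (w : ℂ) * (z : ℂ)) (by
    rw [norm_mul, RCLike.norm_conj]
    exact mul_lt_one_of_nonneg_of_lt_one_left (norm_nonneg _) w.norm_lt_one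
      z.norm_lt_one.le)).mul_right (diskValue f z)
  rw [cauchyKernel, one_div]
  refine h3.congr_eq fun n => ?_
  simp only [smul_eq_mul, mul_pow]
  ring

/-! ### Holomorphic extensions and their dilates -/

theorem integral_comp_toCircle {E : Type*} [NormedAddCommGroup E] [NormedSpace ℝ E]
    (g : ℂ → E) (r : ℝ) :
    ∫ x : UnitAddCircle, g (r * toCircle x) ∂haarAddCircle = Real.circleAverage g 0 r := by
  rw [integral_haarAddCircle, ← AddCircle.intervalIntegral_preimage 1 0, Real.circleAverage_def]
  have h := intervalIntegral.integral_comp_mul_left (a := 0) (b := 1)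
    (fun θ => g (circleMap 0 r θ)) (c := 2 * Real.pi) (by positivity)
  simp only [mul_zero, mul_one] at h
  rw [← h]
  simp only [inv_one, one_smul, zero_add]
  refine intervalIntegral.integral_congr fun x _ => ?_
  simp only [toCircle_apply_mk, circleMap, Circle.coe_exp, zero_add]
  simp

theorem differentiableOn_tsum_pow {c : ℕ → ℂ} {B : ℝ} (hc : ∀ n, ‖c n‖ ≤ B) :
    DifferentiableOn ℂ (fun z : ℂ => ∑' n, c n * z ^ n) (Metric.ball 0 1) := by
  intro z hz
  rw [mem_ball_zero_iff] at hz
  obtain ⟨r, hzr, hr⟩ := exists_between hz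
  have hr0 : 0 ≤ r := (norm_nonneg z).trans hzr.le
  have h : DifferentiableOn ℂ (fun z : ℂ => ∑' n, c n * z ^ n) (Metric.ball 0 r) := by
    refine differentiableOn_tsum_of_summable_norm (u := fun n => B * r ^ n)
      ((summable_geometric_of_lt_one hr0 hr).mul_left B)
      (fun n => by fun_prop) Metric.isOpen_ball fun n w hw => ?_
    rw [mem_ball_zero_iff] at hw
    rw [norm_mul, norm_pow]
    exact mul_le_mul (hc n) (pow_le_pow_left₀ (norm_nonneg _) hw.le _) (by positivity)
      ((norm_nonneg _).trans (hc n))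
  exact (h.differentiableAt (Metric.isOpen_ball.mem_nhds
    (mem_ball_zero_iff.mpr hzr))).differentiableWithinAt

/-- The holomorphic extension of `f ∈ H²`, as a function on `ℂ`. -/
def holo (f : L2Circle) (z : ℂ) : ℂ := ∑' n : ℕ, fourierCoeff f (n : ℤ) * z ^ n

theorem holo_coe (f : L2Circle) (z : UnitDisc) : holo f z = diskValue f z := rfl

theorem norm_fourierCoeff_le (f : L2Circle) (n : ℤ) : ‖fourierCoeff f n‖ ≤ ‖f‖ := by
  rw [fourierCoeff_eq_inner]
  refine (norm_inner_le_norm _ _).trans ?_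
  rw [norm_fourierLp_two, one_mul]

theorem differentiableOn_holo (f : L2Circle) : DifferentiableOn ℂ (holo f) (Metric.ball 0 1) :=
  differentiableOn_tsum_pow fun n => norm_fourierCoeff_le f n

theorem norm_mul_toCircle {r : ℝ} (hr : 0 ≤ r) (x : UnitAddCircle) :
    ‖(r : ℂ) * (toCircle x : ℂ)‖ = r := by
  rw [norm_mul, Circle.norm_coe, mul_one, norm_real, Real.norm_of_nonneg hr]

theorem continuous_toCircle_coe : Continuous fun x : UnitAddCircle => (toCircle x : ℂ) :=
  continuous_subtype_val.comp AddCircle.continuous_toCircle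

theorem ContinuousOn.comp_mul_toCircle {E : Type*} [TopologicalSpace E] {g : ℂ → E}
    (hg : ContinuousOn g (Metric.ball 0 1)) {r : ℝ} (hr : 0 ≤ r) (hr1 : r < 1) :
    Continuous fun x : UnitAddCircle => g (r * toCircle x) := by
  refine hg.comp_continuous (continuous_const.mul continuous_toCircle_coe) fun x => ?_
  rw [mem_ball_zero_iff, norm_mul_toCircle hr]
  exact hr1

/-- The dilate `x ↦ f(r ζ)` as a continuous function on the circle. -/
def dilate (f : L2Circle) {r : ℝ} (hr : 0 ≤ r) (hr1 : r < 1) : C(UnitAddCircle, ℂ) :=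
  ⟨fun x => holo f (r * toCircle x),
    (differentiableOn_holo f).continuousOn.comp_mul_toCircle hr hr1⟩

theorem hasSum_dilate (f : L2Circle) {r : ℝ} (hr : 0 ≤ r) (hr1 : r < 1) :
    HasSum (fun n : ℕ => (fourierCoeff f (n : ℤ) * (r : ℂ) ^ n) •
      (fourier (n : ℤ) : C(UnitAddCircle, ℂ))) (dilate f hr hr1) := by
  have hs : Summable fun n : ℕ => (fourierCoeff f (n : ℤ) * (r : ℂ) ^ n) •
      (fourier (n : ℤ) : C(UnitAddCircle, ℂ)) := by
    refine Summable.of_norm_bounded (g := fun n => ‖f‖ * r ^ n)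
      ((summable_geometric_of_lt_one hr hr1).mul_left _) fun n => ?_
    rw [norm_smul, norm_fourier_one, mul_one, norm_mul, norm_pow, norm_real,
      Real.norm_of_nonneg hr]
    exact mul_le_mul_of_nonneg_right (norm_fourierCoeff_le f n) (by positivity)
  have h := hs.hasSum
  convert h
  ext x
  have h2 := ContinuousMap.hasSum_apply h x
  rw [← h2.tsum_eq]
  change ∑' n : ℕ, _ = _
  refine tsum_congr fun n => ?_
  simp [mul_pow, fourier_apply, toCircle_nsmul, mul_assoc]

theorem fourierCoeff_dilate (f : L2Circle) {r : ℝ} (hr : 0 ≤ r) (hr1 : r < 1) (m : ℤ) :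
    fourierCoeff (ContinuousMap.toLp (E := ℂ) 2 haarAddCircle ℂ (dilate f hr hr1)) m =
      if 0 ≤ m then fourierCoeff f m * (r : ℂ) ^ m.toNat else 0 := by
  have h := ((hasSum_dilate f hr hr1).mapL
    (ContinuousMap.toLp (E := ℂ) 2 haarAddCircle ℂ)).mapL
    (innerSL ℂ (fourierLp 2 m : L2Circle))
  simp only [map_smul, innerSL_apply_apply, smul_eq_mul, ← fourierCoeff_eq_inner] at h
  have e (n : ℕ) : fourierCoeff (ContinuousMap.toLp (E := ℂ) 2 haarAddCircle ℂ
      (fourier (n : ℤ) : C(UnitAddCircle, ℂ))) m = if m = (n : ℤ) then 1 else 0 :=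
    fourierCoeff_fourierLp n m
  simp only [e] at h
  refine h.unique ?_
  split_ifs with hm
  · obtain ⟨k, rfl⟩ := Int.eq_ofNat_of_zero_le hm
    convert hasSum_single k ?_ using 1
    · simp
    · intro n hn
      rw [if_neg (by omega), mul_zero]
  · convert hasSum_zero with n
    rw [if_neg (by omega), mul_zero]

theorem sq_norm_eq_tsum (f : L2Circle) : ‖f‖ ^ 2 = ∑' n : ℤ, ‖fourierCoeff f n‖ ^ 2 := by
  have h := fourierBasis.repr.norm_map f
  have h2 := lp.norm_rpow_eq_tsum (p := 2) (by norm_num) (fourierBasis.repr f)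
  simpa only [ENNReal.toReal_ofNat, Real.rpow_ofNat, h, fourierBasis_repr] using h2

theorem summable_sq_norm_fourierCoeff (f : L2Circle) :
    Summable fun n : ℤ => ‖fourierCoeff f n‖ ^ 2 :=
  (hasSum_sq_fourierCoeff f).summable

theorem fourierCoeff_sub' (f g : L2Circle) (n : ℤ) :
    fourierCoeff (f - g : L2Circle) n = fourierCoeff f n - fourierCoeff g n := by
  simp only [fourierCoeff_eq_inner, inner_sub_right]

theorem integral_norm_le_norm (f : L2Circle) : ∫ x, ‖f x‖ ∂haarAddCircle ≤ ‖f‖ := by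
  have h1 : eLpNorm f 1 haarAddCircle ≤ eLpNorm f 2 haarAddCircle :=
    eLpNorm_le_eLpNorm_of_exponent_le (by norm_num) (Lp.aestronglyMeasurable f)
  rw [integral_norm_eq_lintegral_enorm (Lp.aestronglyMeasurable f),
    ← eLpNorm_one_eq_lintegral_enorm, Lp.norm_def]
  exact ENNReal.toReal_mono (Lp.eLpNorm_ne_top f) h1

/-- By Parseval the squared L² distance is ∑ |f̂(n)|² (1 - rⁿ)², which tends to 0 by dominated
convergence; the L¹ norm is no larger than the L² norm. -/
theorem tendsto_integral_norm_dilate {f : L2Circle} (hf : f ∈ hardySpace) :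
    Tendsto (fun r : ℝ => ∫ x : UnitAddCircle, ‖holo f (r * toCircle x) - f x‖ ∂haarAddCircle)
      (𝓝[<] 1) (𝓝 0) := by
  have hev : ∀ᶠ r : ℝ in 𝓝[<] 1, 0 ≤ r ∧ r < 1 := by
    filter_upwards [Ioo_mem_nhdsLT (zero_lt_one (α := ℝ))] with r hr
    exact ⟨hr.1.le, hr.2⟩
  -- For n < 0 the exponent `n.toNat` is 0 and the factor |r⁰ - 1| vanishes, so the sum may run over
  -- all integers.
  have h2 : Tendsto (fun r : ℝ => Real.sqrt
      (∑' n : ℤ, (‖fourierCoeff f n‖ * |r ^ n.toNat - 1|) ^ 2)) (𝓝[<] 1) (𝓝 0) := by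
    have : Tendsto (fun r : ℝ => ∑' n : ℤ, (‖fourierCoeff f n‖ * |r ^ n.toNat - 1|) ^ 2)
        (𝓝[<] 1) (𝓝 (∑' n : ℤ, 0)) := by
      refine tendsto_tsum_of_dominated_convergence (summable_sq_norm_fourierCoeff f)
        (fun n => ?_) ?_
      · have : Continuous fun r : ℝ => (‖fourierCoeff f n‖ * |r ^ n.toNat - 1|) ^ 2 := by
          fun_prop
        have h := this.tendsto 1
        simp only [one_pow, sub_self, abs_zero, mul_zero, ne_eq, OfNat.ofNat_ne_zero,
          not_false_eq_true, zero_pow] at h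
        exact h.mono_left nhdsWithin_le_nhds
      · filter_upwards [hev] with r hr n
        rw [Real.norm_of_nonneg (by positivity)]
        refine pow_le_pow_left₀ (by positivity) ?_ 2
        refine mul_le_of_le_one_right (norm_nonneg _) ?_
        rw [abs_le]
        constructor <;> linarith [pow_nonneg hr.1 n.toNat, pow_le_one₀ (n := n.toNat) hr.1 hr.2.le]
    rw [tsum_zero] at this
    simpa using this.sqrt
  refine squeeze_zero' (Eventually.of_forall fun r => integral_nonneg fun x => norm_nonneg _) ?_ h2
  filter_upwards [hev] with r hr
  have hD := fourierCoeff_dilate f hr.1 hr.2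
  set D := ContinuousMap.toLp (E := ℂ) 2 haarAddCircle ℂ (dilate f hr.1 hr.2) with hDdef
  have e1 : ∫ x : UnitAddCircle, ‖holo f (r * toCircle x) - f x‖ ∂haarAddCircle =
      ∫ x, ‖(D - f) x‖ ∂haarAddCircle := by
    refine integral_congr_ae ?_
    filter_upwards [Lp.coeFn_sub D f, ContinuousMap.coeFn_toLp (E := ℂ) (p := 2) (𝕜 := ℂ)
      haarAddCircle (dilate f hr.1 hr.2)] with x h1 h2
    rw [h1, Pi.sub_apply, hDdef, h2]
    rfl
  rw [e1]
  refine (integral_norm_le_norm _).trans (le_of_eq ?_)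
  rw [eq_comm, Real.sqrt_eq_iff_mul_self_eq (tsum_nonneg fun n => by positivity) (norm_nonneg _),
    ← sq, sq_norm_eq_tsum]
  refine tsum_congr fun n => ?_
  rw [fourierCoeff_sub', hD]
  split_ifs with hn
  · rw [← mul_sub_one, norm_mul, ← Complex.ofReal_pow, ← Complex.ofReal_one, ← Complex.ofReal_sub,
      norm_real, Real.norm_eq_abs]
  · simp [hf n (by omega)]

/-! ### Jensen's inequality in H² -/

/-- Cutting off at `ε` makes the logarithm Lipschitz, so L¹ convergence of the dilates passes to
their truncated logarithms. -/
theorem abs_log_max_sub_le {ε : ℝ} (hε : 0 < ε) (a b : ℝ) :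
    |Real.log (max a ε) - Real.log (max b ε)| ≤ ε⁻¹ * |a - b| := by
  have key (a b : ℝ) : Real.log (max a ε) - Real.log (max b ε) ≤ ε⁻¹ * |a - b| := by
    have ha : 0 < max a ε := lt_max_of_lt_right hε
    have hb : 0 < max b ε := lt_max_of_lt_right hε
    rw [← Real.log_div ha.ne' hb.ne']
    calc Real.log (max a ε / max b ε) ≤ max a ε / max b ε - 1 :=
          Real.log_le_sub_one_of_pos (by positivity)
      _ = (max b ε)⁻¹ * (max a ε - max b ε) := by field_simp
      _ ≤ (max b ε)⁻¹ * |a - b| := by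
          gcongr
          exact (le_abs_self _).trans (abs_max_sub_max_le_abs a b ε)
      _ ≤ ε⁻¹ * |a - b| := by
          gcongr
          exact le_max_right _ _
  rw [abs_le]
  refine ⟨?_, key a b⟩
  have := key b a
  rw [abs_sub_comm] at this
  linarith

theorem integrable_norm (f : L2Circle) :
    Integrable (fun x => ‖f x‖) (haarAddCircle : Measure UnitAddCircle) :=
  ((Lp.memLp f).integrable (by norm_num)).norm

theorem integrable_log_max {ε : ℝ} (hε : 0 < ε) (f : L2Circle) :
    Integrable (fun x => Real.log (max ‖f x‖ ε)) (haarAddCircle : Measure UnitAddCircle) := by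
  have hm : AEStronglyMeasurable (fun x => Real.log (max ‖f x‖ ε))
      (haarAddCircle : Measure UnitAddCircle) :=
    (Real.measurable_log.comp_aemeasurable (((Lp.aestronglyMeasurable f).norm.aemeasurable).max
      aemeasurable_const)).aestronglyMeasurable
  refine Integrable.mono' (((integrable_norm f).const_mul ε⁻¹).add
    (integrable_const |Real.log ε|)) hm (Eventually.of_forall fun x => ?_)
  have h := abs_log_max_sub_le hε ‖f x‖ 0
  rw [max_eq_right hε.le, sub_zero, abs_norm] at h
  have h2 := abs_sub_abs_le_abs_sub (Real.log (max ‖f x‖ ε)) (Real.log ε)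
  simp only [Real.norm_eq_abs, Pi.add_apply]
  linarith

theorem integrable_of_continuous {E : Type*} [NormedAddCommGroup E] [SecondCountableTopology E]
    {g : UnitAddCircle → E} (hg : Continuous g) :
    Integrable g (haarAddCircle : Measure UnitAddCircle) := by
  borelize E
  exact hg.integrable_of_hasCompactSupport (HasCompactSupport.of_compactSpace g)

theorem continuous_log_max {ε : ℝ} (hε : 0 < ε) : Continuous fun a : ℝ => Real.log (max a ε) :=
  (continuous_id.max continuous_const).log fun _ => (lt_max_of_lt_right hε).ne'

/-- In Jensen's formula each zero contributes a nonnegative term, and truncation from below only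
increases the average. -/
theorem log_norm_le_circleAverage {F : ℂ → ℂ} (hF : DifferentiableOn ℂ F (Metric.ball 0 1))
    (h0 : F 0 ≠ 0) {r : ℝ} (hr : 0 < r) (hr1 : r < 1) {ε : ℝ} (hε : 0 < ε) :
    Real.log ‖F 0‖ ≤ Real.circleAverage (fun z => Real.log (max ‖F z‖ ε)) 0 r := by
  have hsub : Metric.closedBall (0 : ℂ) |r| ⊆ Metric.ball 0 1 := by
    rw [abs_of_pos hr]
    exact Metric.closedBall_subset_ball hr1
  have hsub' : Metric.sphere (0 : ℂ) |r| ⊆ Metric.ball 0 1 :=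
    Metric.sphere_subset_closedBall.trans hsub
  have hA : AnalyticOnNhd ℂ F (Metric.ball 0 1) := hF.analyticOnNhd Metric.isOpen_ball
  have hJ := (hA.mono hsub).circleAverage_log_norm hr.ne' h0
  have hpos : 0 ≤ ∑ᶠ u, MeromorphicOn.divisor F (Metric.closedBall 0 |r|) u *
      Real.log (r * ‖0 - u‖⁻¹) := by
    refine finsum_nonneg fun u => ?_
    by_cases hu : u ∈ Metric.closedBall (0 : ℂ) |r|
    · refine mul_nonneg ?_ ?_
      · exact_mod_cast (MeromorphicOn.AnalyticOnNhd.divisor_nonneg (hA.mono hsub)) u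
      · rcases eq_or_ne u 0 with rfl | hu0
        · simp
        · refine Real.log_nonneg ?_
          rw [zero_sub, norm_neg, ← div_eq_mul_inv, one_le_div (norm_pos_iff.mpr hu0)]
          simpa [abs_of_pos hr] using hu
    · simp [hu]
  have hcod : F ⁻¹' {0}ᶜ ∈ codiscreteWithin (Metric.sphere (0 : ℂ) |r|) :=
    codiscreteWithin_mono hsub' (hA.preimage_zero_mem_codiscreteWithin h0
      (Metric.mem_ball_self one_pos)
      ((convex_ball (0 : ℂ) 1).isConnected ⟨0, Metric.mem_ball_self one_pos⟩))
  -- At a zero of `F` the convention `Real.log 0 = 0` can exceed `Real.log ε`. Changing the values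
  -- at these isolated points restores the pointwise bound and leaves the average unchanged.
  set g : ℂ → ℝ := fun z => if F z = 0 then Real.log ε else Real.log ‖F z‖ with hg
  have hcong : (fun z => Real.log ‖F z‖) =ᶠ[codiscreteWithin (Metric.sphere (0 : ℂ) |r|)] g := by
    filter_upwards [hcod] with z hz
    rw [hg]
    simp only [Set.mem_preimage, Set.mem_compl_iff, Set.mem_singleton_iff] at hz
    simp [hz]
  have hint : CircleIntegrable (fun z => Real.log ‖F z‖) 0 r :=
    (hA.mono hsub').meromorphicOn.circleIntegrable_log_norm
  calc Real.log ‖F 0‖ ≤ Real.circleAverage (fun z => Real.log ‖F z‖) 0 r := by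
        rw [hJ]
        linarith
    _ = Real.circleAverage g 0 r := Real.circleAverage_congr_codiscreteWithin hcong hr.ne'
    _ ≤ _ := by
        refine Real.circleAverage_mono (hint.congr_codiscreteWithin hcong) ?_ fun z hz => ?_
        · refine ContinuousOn.circleIntegrable' ?_
          exact (continuous_log_max hε).comp_continuousOn (hF.continuousOn.mono hsub').norm
        · rw [hg]
          dsimp only
          split_ifs with hz
          · exact Real.log_le_log hε (le_max_right _ _)
          · exact Real.log_le_log (norm_pos_iff.mpr hz) (le_max_left _ _)

theorem tendsto_integral_log_max {f : L2Circle} (hf : f ∈ hardySpace) {ε : ℝ} (hε : 0 < ε) :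
    Tendsto (fun r : ℝ => ∫ x : UnitAddCircle, |Real.log (max ‖holo f (r * toCircle x)‖ ε) -
      Real.log (max ‖f x‖ ε)| ∂haarAddCircle) (𝓝[<] 1) (𝓝 0) := by
  have h := (tendsto_integral_norm_dilate hf).const_mul ε⁻¹
  rw [mul_zero] at h
  refine squeeze_zero' (Eventually.of_forall fun r => integral_nonneg fun x => abs_nonneg _) ?_ h
  filter_upwards [Ioo_mem_nhdsLT (zero_lt_one (α := ℝ))] with r hr
  have hc := (differentiableOn_holo f).continuousOn.comp_mul_toCircle hr.1.le hr.2
  rw [← integral_const_mul]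
  refine integral_mono_of_nonneg (Eventually.of_forall fun x => abs_nonneg _) ?_
    (Eventually.of_forall fun x => ?_)
  · exact (((integrable_of_continuous hc).sub
      ((Lp.memLp f).integrable (by norm_num))).norm).const_mul _
  · exact (abs_log_max_sub_le hε _ _).trans
      (mul_le_mul_of_nonneg_left (abs_norm_sub_norm_le _ _) (by positivity))

theorem log_norm_le_integral_log_max {f : L2Circle} (hf : f ∈ hardySpace) (h0 : holo f 0 ≠ 0)
    {ε : ℝ} (hε : 0 < ε) :
    Real.log ‖holo f 0‖ ≤ ∫ x, Real.log (max ‖f x‖ ε) ∂haarAddCircle := by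
  have h := (tendsto_integral_log_max hf hε).add_const
    (∫ x, Real.log (max ‖f x‖ ε) ∂haarAddCircle)
  rw [zero_add] at h
  refine ge_of_tendsto h ?_
  filter_upwards [Ioo_mem_nhdsLT (zero_lt_one (α := ℝ))] with r hr
  have hc := (differentiableOn_holo f).continuousOn.comp_mul_toCircle hr.1.le hr.2
  have hi1 : Integrable (fun x : UnitAddCircle =>
      Real.log (max ‖holo f (r * toCircle x)‖ ε)) haarAddCircle :=
    integrable_of_continuous ((continuous_log_max hε).comp hc.norm)
  have hi2 := integrable_log_max hε f
  have h1 := log_norm_le_circleAverage (differentiableOn_holo f) h0 hr.1 hr.2 hε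
  rw [← integral_comp_toCircle] at h1
  refine h1.trans ?_
  rw [← sub_le_iff_le_add, ← integral_sub hi1 hi2]
  exact integral_mono (hi1.sub hi2) (hi1.sub hi2).abs fun x => le_abs_self _

theorem log_max_le {a ε : ℝ} (ha : 0 ≤ a) (hε : 0 < ε) (hε1 : ε ≤ 1) :
    Real.log (max a ε) ≤ a := by
  rcases le_total a ε with h | h
  · rw [max_eq_right h]
    exact (Real.log_nonpos hε.le hε1).trans ha
  · rw [max_eq_left h]
    exact (Real.log_le_sub_one_of_pos (hε.trans_le h)).trans (by linarith)

theorem tendsto_log_max {a : ℝ} (ha : 0 < a) :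
    Tendsto (fun n : ℕ => Real.log (max a (1 / ((n : ℝ) + 1)))) atTop (𝓝 (Real.log a)) := by
  have h := (tendsto_const_nhds (x := a)).max (tendsto_one_div_add_atTop_nhds_zero_nat (𝕜 := ℝ))
  rw [max_eq_left ha.le] at h
  exact h.log ha.ne'

/-- Jensen's inequality at the centre for functions in `H²`. -/
theorem jensen_hardySpace {f : L2Circle} (hf : f ∈ hardySpace) (h0 : holo f 0 ≠ 0) :
    (∀ᵐ x ∂(haarAddCircle : Measure UnitAddCircle), f x ≠ 0) ∧
    Integrable (fun x => Real.log ‖f x‖) (haarAddCircle : Measure UnitAddCircle) ∧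
    Real.log ‖holo f 0‖ ≤ ∫ x, Real.log ‖f x‖ ∂haarAddCircle := by
  have hpos (n : ℕ) : (0 : ℝ) < 1 / ((n : ℝ) + 1) := Nat.one_div_pos_of_nat
  have hle (n : ℕ) : 1 / ((n : ℝ) + 1) ≤ 1 := by
    rw [div_le_one (by positivity)]
    linarith [n.cast_nonneg (α := ℝ)]
  -- Subtracting from ‖f‖ gives nonnegative functions, since the cutoffs are at most 1; their
  -- integrals are bounded by `K`, so Fatou's lemma applies.
  set w : ℕ → UnitAddCircle → ℝ := fun n x => ‖f x‖ - Real.log (max ‖f x‖ (1 / ((n : ℝ) + 1)))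
    with hw
  have hw0 (n : ℕ) (x) : 0 ≤ w n x := sub_nonneg.mpr (log_max_le (norm_nonneg _) (hpos n) (hle n))
  have hwi (n : ℕ) : Integrable (w n) haarAddCircle :=
    (integrable_norm f).sub (integrable_log_max (hpos n) f)
  set K : ℝ := ∫ x, ‖f x‖ ∂haarAddCircle - Real.log ‖holo f 0‖ with hK
  have hwK (n : ℕ) : ∫⁻ x, ENNReal.ofReal (w n x) ∂haarAddCircle ≤ ENNReal.ofReal K := by
    rw [← ofReal_integral_eq_lintegral_ofReal (hwi n) (Eventually.of_forall (hw0 n))]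
    refine ENNReal.ofReal_le_ofReal ?_
    rw [hw, integral_sub (integrable_norm f) (integrable_log_max (hpos n) f)]
    linarith [log_norm_le_integral_log_max hf h0 (hpos n)]
  have hF : ∫⁻ x, liminf (fun n => ENNReal.ofReal (w n x)) atTop ∂haarAddCircle ≤
      ENNReal.ofReal K := by
    refine (lintegral_liminf_le' fun n => (hwi n).aemeasurable.ennreal_ofReal).trans ?_
    refine liminf_le_of_le (by isBoundedDefault) fun b hb => ?_
    obtain ⟨n, hn⟩ := hb.exists
    exact hn.trans (hwK n)
  have hne : ∀ᵐ x ∂(haarAddCircle : Measure UnitAddCircle), f x ≠ 0 := by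
    have hmf : Measurable f := (Lp.stronglyMeasurable f).measurable
    have hmw (n : ℕ) : Measurable (w n) :=
      hmf.norm.sub (Real.measurable_log.comp (hmf.norm.max measurable_const))
    have hlt := ae_lt_top' (Measurable.liminf fun n =>
      (hmw n).ennreal_ofReal).aemeasurable
      (hF.trans_lt ENNReal.ofReal_lt_top).ne
    -- Where `f` vanishes, `w n` equals log(n + 1) and the lower limit is infinite; by Fatou this
    -- happens only on a null set.
    filter_upwards [hlt] with x hx hfx
    refine hx.ne (Tendsto.liminf_eq ?_)
    refine ENNReal.tendsto_ofReal_atTop.comp ?_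
    have e : (fun n => w n x) = fun n : ℕ => Real.log ((n : ℝ) + 1) := by
      funext n
      simp only [hw, hfx, norm_zero, max_eq_right (hpos n).le]
      simp
    rw [e]
    exact Real.tendsto_log_atTop.comp
      (tendsto_atTop_add_const_right _ _ tendsto_natCast_atTop_atTop)
  have hlim : ∀ᵐ x ∂(haarAddCircle : Measure UnitAddCircle),
      liminf (fun n => ENNReal.ofReal (w n x)) atTop = ENNReal.ofReal (‖f x‖ - Real.log ‖f x‖) := by
    filter_upwards [hne] with x hx
    exact (ENNReal.tendsto_ofReal
      ((tendsto_log_max (norm_pos_iff.mpr hx)).const_sub _)).liminf_eq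
  rw [lintegral_congr_ae hlim] at hF
  have hm : AEStronglyMeasurable (fun x => Real.log ‖f x‖)
      (haarAddCircle : Measure UnitAddCircle) :=
    (Real.measurable_log.comp_aemeasurable
      (Lp.aestronglyMeasurable f).norm.aemeasurable).aestronglyMeasurable
  have hnn : ∀ x, 0 ≤ ‖f x‖ - Real.log ‖f x‖ := fun x => by
    have := Real.log_le_self (norm_nonneg (f x))
    linarith
  have hi : Integrable (fun x => ‖f x‖ - Real.log ‖f x‖)
      (haarAddCircle : Measure UnitAddCircle) := by
    refine ⟨(Lp.aestronglyMeasurable f).norm.sub hm, ?_⟩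
    rw [hasFiniteIntegral_iff_ofReal (Eventually.of_forall hnn)]
    exact hF.trans_lt ENNReal.ofReal_lt_top
  have hi' : Integrable (fun x => Real.log ‖f x‖) (haarAddCircle : Measure UnitAddCircle) := by
    refine ((integrable_norm f).sub hi).congr (Eventually.of_forall fun x => ?_)
    simp
  refine ⟨hne, hi', ?_⟩
  have hK0 : 0 ≤ K := (integral_nonneg (hw0 0)).trans (by
    rw [hw, integral_sub (integrable_norm f) (integrable_log_max (hpos 0) f)]
    linarith [log_norm_le_integral_log_max hf h0 (hpos 0)])
  rw [← ofReal_integral_eq_lintegral_ofReal hi (Eventually.of_forall hnn),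
    ENNReal.ofReal_le_ofReal_iff hK0, integral_sub (integrable_norm f) hi'] at hF
  linarith

/-! ### Equality in Jensen's inequality and the outer representation -/

theorem tendsto_integral_log_max_sub {f : L2Circle}
    (hne : ∀ᵐ x ∂(haarAddCircle : Measure UnitAddCircle), f x ≠ 0)
    (hi : Integrable (fun x => Real.log ‖f x‖) (haarAddCircle : Measure UnitAddCircle)) :
    Tendsto (fun n : ℕ => ∫ x, Real.log (max ‖f x‖ (1 / ((n : ℝ) + 1))) ∂haarAddCircle) atTop
      (𝓝 (∫ x, Real.log ‖f x‖ ∂haarAddCircle)) := by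
  have hpos (n : ℕ) : (0 : ℝ) < 1 / ((n : ℝ) + 1) := Nat.one_div_pos_of_nat
  have hle (n : ℕ) : 1 / ((n : ℝ) + 1) ≤ 1 := by
    rw [div_le_one (by positivity)]
    linarith [n.cast_nonneg (α := ℝ)]
  refine tendsto_integral_of_dominated_convergence
    (fun x => ‖f x‖ + |Real.log ‖f x‖|)
    (fun n => (integrable_log_max (hpos n) f).aestronglyMeasurable)
    ((integrable_norm f).add hi.abs) (fun n => ?_) ?_
  · filter_upwards [hne] with x hx
    have h1 := log_max_le (norm_nonneg (f x)) (hpos n) (hle n)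
    have h2 := Real.log_le_log (norm_pos_iff.mpr hx) (le_max_left ‖f x‖ (1 / ((n : ℝ) + 1)))
    rw [Real.norm_eq_abs, abs_le]
    constructor
    · linarith [neg_abs_le (Real.log ‖f x‖), norm_nonneg (f x)]
    · linarith [abs_nonneg (Real.log ‖f x‖)]
  · filter_upwards [hne] with x hx
    exact tendsto_log_max (norm_pos_iff.mpr hx)

theorem integral_log_norm_dilate {f : L2Circle} (hz : ∀ z ∈ Metric.ball (0 : ℂ) 1, holo f z ≠ 0)
    {r : ℝ} (hr : 0 < r) (hr1 : r < 1) :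
    ∫ x : UnitAddCircle, Real.log ‖holo f (r * toCircle x)‖ ∂haarAddCircle =
      Real.log ‖holo f 0‖ := by
  rw [integral_comp_toCircle (fun z => Real.log ‖holo f z‖)]
  have hsub : Metric.closedBall (0 : ℂ) |r| ⊆ Metric.ball 0 1 := by
    rw [abs_of_pos hr]
    exact Metric.closedBall_subset_ball hr1
  exact AnalyticOnNhd.circleAverage_log_norm_of_ne_zero
    (((differentiableOn_holo f).analyticOnNhd Metric.isOpen_ball).mono hsub)
    fun u hu => hz u (hsub hu)

theorem continuous_log_norm_dilate {f : L2Circle}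
    (hz : ∀ z ∈ Metric.ball (0 : ℂ) 1, holo f z ≠ 0) {r : ℝ} (hr : 0 ≤ r) (hr1 : r < 1) :
    Continuous fun x : UnitAddCircle => Real.log ‖holo f (r * toCircle x)‖ := by
  refine ((differentiableOn_holo f).continuousOn.comp_mul_toCircle hr hr1).norm.log fun x => ?_
  rw [norm_ne_zero_iff]
  refine hz _ ?_
  rw [mem_ball_zero_iff, norm_mul_toCircle hr]
  exact hr1

/-- Zero-freeness makes the mean of log|f(rζ)| equal to log|f(0)| for every r, and by hypothesis
this is also the mean of log|f|. With no mass lost, convergence of the truncated logarithms upgrades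
to L¹ convergence of the logarithms. -/
theorem tendsto_integral_abs_log_sub {f : L2Circle} (hf : f ∈ hardySpace)
    (hz : ∀ z ∈ Metric.ball (0 : ℂ) 1, holo f z ≠ 0)
    (heq : ∫ x, Real.log ‖f x‖ ∂haarAddCircle = Real.log ‖holo f 0‖) :
    Tendsto (fun r : ℝ => ∫ x : UnitAddCircle,
      |Real.log ‖holo f (r * toCircle x)‖ - Real.log ‖f x‖| ∂haarAddCircle) (𝓝[<] 1) (𝓝 0) := by
  obtain ⟨hne, hi, -⟩ := jensen_hardySpace hf (hz 0 (Metric.mem_ball_self one_pos))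
  refine tendsto_order.mpr ⟨fun a ha => Eventually.of_forall fun r =>
    ha.trans_le (integral_nonneg fun x => abs_nonneg _), fun η hη => ?_⟩
  -- Three errors are summed: truncating log|f(rζ)|, comparing the truncations, truncating log|f|.
  -- The last two are below η/4 each, and equality of means bounds the first by their sum.
  obtain ⟨n, hn⟩ := ((tendsto_integral_log_max_sub hne hi).eventually_lt_const
    (show _ < ∫ x, Real.log ‖f x‖ ∂haarAddCircle + η / 4 by linarith)).exists
  set ε : ℝ := 1 / ((n : ℝ) + 1) with hεdef
  have hε : 0 < ε := Nat.one_div_pos_of_nat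
  have hA := (tendsto_integral_log_max hf hε).eventually_lt_const (show 0 < η / 4 by linarith)
  filter_upwards [hA, Ioo_mem_nhdsLT (zero_lt_one (α := ℝ))] with r hrA hr
  have hc := continuous_log_norm_dilate hz hr.1.le hr.2
  have hi1 := integrable_of_continuous hc
  have hi2 : Integrable (fun x : UnitAddCircle =>
      Real.log (max ‖holo f (r * toCircle x)‖ ε)) haarAddCircle :=
    integrable_of_continuous ((continuous_log_max hε).comp
      ((differentiableOn_holo f).continuousOn.comp_mul_toCircle hr.1.le hr.2).norm)
  have hi3 := integrable_log_max hε f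
  have e1 := integral_log_norm_dilate hz hr.1 hr.2
  have hle : ∫ x : UnitAddCircle, Real.log (max ‖holo f (r * toCircle x)‖ ε) ∂haarAddCircle -
      ∫ x, Real.log (max ‖f x‖ ε) ∂haarAddCircle ≤ ∫ x : UnitAddCircle,
      |Real.log (max ‖holo f (r * toCircle x)‖ ε) - Real.log (max ‖f x‖ ε)| ∂haarAddCircle := by
    rw [← integral_sub hi2 hi3]
    exact integral_mono (hi2.sub hi3) (hi2.sub hi3).abs fun x => le_abs_self _
  have hmain : ∫ x : UnitAddCircle,
      |Real.log ‖holo f (r * toCircle x)‖ - Real.log ‖f x‖| ∂haarAddCircle ≤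
      (∫ x : UnitAddCircle, (Real.log (max ‖holo f (r * toCircle x)‖ ε) -
        Real.log ‖holo f (r * toCircle x)‖) ∂haarAddCircle) +
      (∫ x : UnitAddCircle,
        |Real.log (max ‖holo f (r * toCircle x)‖ ε) - Real.log (max ‖f x‖ ε)| ∂haarAddCircle) +
      ∫ x, (Real.log (max ‖f x‖ ε) - Real.log ‖f x‖) ∂haarAddCircle := by
    have j1 : Integrable (fun x : UnitAddCircle => Real.log (max ‖holo f (r * toCircle x)‖ ε) -
        Real.log ‖holo f (r * toCircle x)‖) haarAddCircle := hi2.sub hi1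
    have j2 : Integrable (fun x : UnitAddCircle =>
        |Real.log (max ‖holo f (r * toCircle x)‖ ε) - Real.log (max ‖f x‖ ε)|) haarAddCircle :=
      (hi2.sub hi3).abs
    have j3 : Integrable (fun x => Real.log (max ‖f x‖ ε) - Real.log ‖f x‖) haarAddCircle :=
      hi3.sub hi
    refine le_trans (integral_mono_ae (hi1.sub hi).abs ((j1.add j2).add j3) ?_)
      (le_of_eq ((integral_add (j1.add j2) j3).trans (congrArg (· + _) (integral_add j1 j2))))
    filter_upwards [hne] with x hx
    have hb : holo f (r * toCircle x) ≠ 0 := by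
      refine hz _ ?_
      rw [mem_ball_zero_iff, norm_mul_toCircle hr.1.le]
      exact hr.2
    have h1 := Real.log_le_log (norm_pos_iff.mpr hx) (le_max_left ‖f x‖ ε)
    have h2 := Real.log_le_log (norm_pos_iff.mpr hb) (le_max_left _ ε)
    have h3 := abs_le.mp (le_refl
      |Real.log (max ‖holo f (r * toCircle x)‖ ε) - Real.log (max ‖f x‖ ε)|)
    simp only [Pi.add_apply]
    rw [abs_le]
    constructor <;> linarith [h3.1, h3.2]
  rw [integral_sub hi2 hi1, integral_sub hi3 hi] at hmain
  linarith

theorem exists_log_of_ne_zero {F : ℂ → ℂ} (hF : DifferentiableOn ℂ F (Metric.ball 0 1))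
    (hz : ∀ z ∈ Metric.ball (0 : ℂ) 1, F z ≠ 0) :
    ∃ L : ℂ → ℂ, DifferentiableOn ℂ L (Metric.ball 0 1) ∧
      ∀ z ∈ Metric.ball (0 : ℂ) 1, Complex.exp (L z) = F z := by
  have hd : DifferentiableOn ℂ (fun z => deriv F z / F z) (Metric.ball 0 1) :=
    (hF.deriv Metric.isOpen_ball).div hF hz
  obtain ⟨L, hL0, hL⟩ := hd.isExactOn_ball.with_val_at 0 (Complex.log (F 0))
  have h0 : (0 : ℂ) ∈ Metric.ball (0 : ℂ) 1 := Metric.mem_ball_self one_pos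
  refine ⟨L, fun z h => (hL z h).differentiableAt.differentiableWithinAt, fun z h => ?_⟩
  have hder (z) (h : z ∈ Metric.ball (0 : ℂ) 1) :
      HasDerivAt (fun z => F z * Complex.exp (-L z)) 0 z := by
    have h1 := (hF.differentiableAt (Metric.isOpen_ball.mem_nhds h)).hasDerivAt
    refine (h1.mul (hL z h).neg.cexp).congr_deriv ?_
    have e : F z * (deriv F z / F z) = deriv F z := mul_div_cancel₀ _ (hz z h)
    rw [Pi.neg_apply]
    linear_combination -Complex.exp (-L z) * e
  have hconst := Metric.isOpen_ball.is_const_of_deriv_eq_zero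
    (convex_ball (0 : ℂ) 1).isPreconnected
    (fun z h => (hder z h).differentiableAt.differentiableWithinAt)
    (fun z h => (hder z h).deriv) h h0
  simp only [hL0, Complex.exp_neg, Complex.exp_log (hz 0 h0), mul_inv_cancel₀ (hz 0 h0)] at hconst
  rw [mul_inv_eq_one₀ (Complex.exp_ne_zero _)] at hconst
  exact hconst.symm

/-- The kernel `(ζ + z) / (ζ - z)` on the circle. -/
def herglotz (z : UnitDisc) (x : UnitAddCircle) : ℂ :=
  ((toCircle x : ℂ) + (z : ℂ)) / ((toCircle x : ℂ) - (z : ℂ))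

theorem toCircle_sub_ne_zero (z : UnitDisc) (x : UnitAddCircle) :
    (toCircle x : ℂ) - (z : ℂ) ≠ 0 := by
  intro h
  have h1 : ‖(toCircle x : ℂ)‖ = ‖(z : ℂ)‖ := by rw [sub_eq_zero.mp h]
  rw [Circle.norm_coe] at h1
  exact z.norm_lt_one.ne h1.symm

theorem continuous_herglotz (z : UnitDisc) : Continuous (herglotz z) :=
  (continuous_toCircle_coe.add continuous_const).div
    (continuous_toCircle_coe.sub continuous_const) (toCircle_sub_ne_zero z)

/-- The Schwarz integral formula. -/
theorem integral_herglotz_re {G : ℂ → ℂ} (hG : DiffContOnCl ℂ G (Metric.ball 0 1)) (z : UnitDisc) :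
    ∫ x : UnitAddCircle, herglotz z x * ((G (toCircle x)).re : ℂ) ∂haarAddCircle =
      G z - (G 0).im * I := by
  have hzb : (z : ℂ) ∈ Metric.ball (0 : ℂ) 1 := by
    rw [mem_ball_zero_iff]
    exact z.norm_lt_one
  have hGc : Continuous fun x : UnitAddCircle => G (toCircle x) := by
    refine hG.continuousOn.comp_continuous continuous_toCircle_coe fun x => ?_
    rw [closure_ball _ one_ne_zero, mem_closedBall_zero_iff, Circle.norm_coe]
  have hG' : DiffContOnCl ℂ G (Metric.ball 0 |1|) := by rwa [abs_one]
  have hzb' : (z : ℂ) ∈ Metric.ball (0 : ℂ) |1| := by rwa [abs_one]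
  have key (g : ℂ → ℂ) : ∫ x : UnitAddCircle, g (toCircle x) ∂haarAddCircle =
      Real.circleAverage g 0 1 := by
    rw [← integral_comp_toCircle g 1]
    simp
  have hH := continuous_herglotz z
  have m1 : ∫ x : UnitAddCircle, G (toCircle x) ∂haarAddCircle = G 0 := by
    rw [key G, hG'.circleAverage]
  have m2 : ∫ x : UnitAddCircle, ((toCircle x : ℂ) / ((toCircle x : ℂ) - z)) * G (toCircle x)
      ∂haarAddCircle = G z := by
    have h := hG'.circleAverage_smul_div hzb'
    rw [← key] at h
    simpa using h
  have m3 : ∫ x : UnitAddCircle, ((herglotz z x).re : ℂ) * G (toCircle x) ∂haarAddCircle = G z := by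
    have h := hG.circleAverage_re_herglotzRieszKernel_smul' hzb
    rw [← key] at h
    simpa [herglotz] using h
  have hc2 : Continuous fun x : UnitAddCircle =>
      ((toCircle x : ℂ) / ((toCircle x : ℂ) - z)) * G (toCircle x) :=
    (continuous_toCircle_coe.div (continuous_toCircle_coe.sub continuous_const)
      (toCircle_sub_ne_zero z)).mul hGc
  have hc3 : Continuous fun x : UnitAddCircle => ((herglotz z x).re : ℂ) * G (toCircle x) :=
    (continuous_ofReal.comp (continuous_re.comp hH)).mul hGc
  have i1 := integrable_of_continuous hGc
  have i2 := integrable_of_continuous hc2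
  have i3 := integrable_of_continuous hc3
  -- The kernel equals 2ζ/(ζ - z) - 1, so Cauchy's formula and the mean value property give the
  -- integral.
  have e1 : ∫ x : UnitAddCircle, herglotz z x * G (toCircle x) ∂haarAddCircle =
      2 * G z - G 0 := by
    have h := integral_sub (i2.const_mul 2) i1
    rw [integral_const_mul, m1, m2] at h
    rw [← h]
    refine integral_congr_ae (Eventually.of_forall fun x => ?_)
    simp only [herglotz]
    field_simp [toCircle_sub_ne_zero z x]
    ring
  have i4 : Integrable (fun x : UnitAddCircle => herglotz z x * G (toCircle x)) haarAddCircle :=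
    integrable_of_continuous (hH.mul hGc)
  -- The conjugate kernel is twice the Poisson kernel minus the kernel. Conjugating the result
  -- integrates the kernel against conj G, and averaging with `e1` yields Re G.
  have e2 : ∫ x : UnitAddCircle, conj (herglotz z x) * G (toCircle x) ∂haarAddCircle = G 0 := by
    have h := integral_sub (i3.const_mul 2) i4
    rw [integral_const_mul, m3, e1] at h
    have : G 0 = 2 * G z - (2 * G z - G 0) := by ring
    rw [this, ← h]
    refine integral_congr_ae (Eventually.of_forall fun x => ?_)
    simp only
    have := add_conj (herglotz z x)
    rw [ofReal_mul, ofReal_ofNat] at this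
    linear_combination G (toCircle x) * this
  have e3 : ∫ x : UnitAddCircle, herglotz z x * conj (G (toCircle x)) ∂haarAddCircle =
      conj (G 0) := by
    rw [← e2, ← integral_conj]
    refine integral_congr_ae (Eventually.of_forall fun x => ?_)
    simp
  have i5 : Integrable (fun x : UnitAddCircle => herglotz z x * conj (G (toCircle x)))
      haarAddCircle := integrable_of_continuous (hH.mul (continuous_conj.comp hGc))
  have h := integral_add (i4.const_mul (1 / 2)) (i5.const_mul (1 / 2))
  rw [integral_const_mul, integral_const_mul, e1, e3] at h
  have e4 : G z - (G 0).im * I = 1 / 2 * (2 * G z - G 0) + 1 / 2 * conj (G 0) := by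
    have := sub_conj (G 0)
    push_cast at this
    linear_combination (1 / 2 : ℂ) * this
  rw [e4, ← h]
  refine integral_congr_ae (Eventually.of_forall fun x => ?_)
  simp only
  have := add_conj (G (toCircle x))
  push_cast at this
  linear_combination (-1 / 2 : ℂ) * herglotz z x * this

/-- A function in `H²` without zeros in the disc which attains equality in Jensen's inequality is
outer. -/
theorem isOuter_of_integral_log_eq {f : L2Circle} (hf : f ∈ hardySpace)
    (hz : ∀ z ∈ Metric.ball (0 : ℂ) 1, holo f z ≠ 0)
    (heq : ∫ x, Real.log ‖f x‖ ∂haarAddCircle = Real.log ‖holo f 0‖) : IsOuter f := by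
  obtain ⟨hne, hi, -⟩ := jensen_hardySpace hf (hz 0 (Metric.mem_ball_self one_pos))
  obtain ⟨L, hL, hexp⟩ := exists_log_of_ne_zero (differentiableOn_holo f) hz
  refine ⟨hf, hne, hi, Complex.exp ((L 0).im * I), norm_exp_ofReal_mul_I _, fun z => ?_⟩
  rw [← holo_coe]
  change _ = _ * Complex.exp (∫ x, herglotz z x * (Real.log ‖f x‖ : ℂ) ∂haarAddCircle)
  -- The Schwarz formula for L(r·), where exp L = f; the unimodular constant is exp(i Im L(0)),
  -- independent of r.
  have hr (r : ℝ) (hr0 : 0 < r) (hr1 : r < 1) : holo f (r * z) = Complex.exp ((L 0).im * I) *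
      Complex.exp (∫ x : UnitAddCircle,
        herglotz z x * (Real.log ‖holo f (r * toCircle x)‖ : ℂ) ∂haarAddCircle) := by
    have hmaps (w : ℂ) (hw : w ∈ Metric.closedBall (0 : ℂ) 1) :
        (r : ℂ) * w ∈ Metric.ball (0 : ℂ) 1 := by
      rw [mem_closedBall_zero_iff] at hw
      rw [mem_ball_zero_iff, norm_mul, norm_real, Real.norm_of_nonneg hr0.le]
      exact (mul_le_of_le_one_right hr0.le hw).trans_lt hr1
    have hG : DiffContOnCl ℂ (fun w => L (r * w)) (Metric.ball 0 1) := by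
      refine DifferentiableOn.diffContOnCl ?_
      rw [closure_ball _ one_ne_zero]
      exact hL.comp (by fun_prop) hmaps
    have h := integral_herglotz_re hG z
    simp only [mul_zero] at h
    have e : ∫ x : UnitAddCircle,
        herglotz z x * (Real.log ‖holo f (r * toCircle x)‖ : ℂ) ∂haarAddCircle =
        L (r * z) - (L 0).im * I := by
      rw [← h]
      refine integral_congr_ae (Eventually.of_forall fun x => ?_)
      simp only
      rw [← hexp _ (hmaps _ (by simp [Circle.norm_coe])), norm_exp, Real.log_exp]
    rw [e, ← Complex.exp_add, add_sub_cancel, hexp]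
    refine hmaps _ ?_
    rw [mem_closedBall_zero_iff]
    exact z.norm_lt_one.le
  have hlim1 : Tendsto (fun r : ℝ => holo f (r * z)) (𝓝[<] 1) (𝓝 (holo f z)) := by
    have hcz : ContinuousAt (holo f) z := (differentiableOn_holo f).continuousOn.continuousAt
      (Metric.isOpen_ball.mem_nhds (mem_ball_zero_iff.mpr z.norm_lt_one))
    refine hcz.tendsto.comp ?_
    have : Continuous fun r : ℝ => (r : ℂ) * z := by fun_prop
    have h := this.tendsto 1
    rw [ofReal_one, one_mul] at h
    exact h.mono_left nhdsWithin_le_nhds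
  have hlim2 : Tendsto (fun r : ℝ => ∫ x : UnitAddCircle,
      herglotz z x * (Real.log ‖holo f (r * toCircle x)‖ : ℂ) ∂haarAddCircle) (𝓝[<] 1)
      (𝓝 (∫ x, herglotz z x * (Real.log ‖f x‖ : ℂ) ∂haarAddCircle)) := by
    obtain ⟨C, hC⟩ := (isCompact_range (continuous_herglotz z)).isBounded.exists_norm_le
    have hCx (x) : ‖herglotz z x‖ ≤ C := hC _ ⟨x, rfl⟩
    have h := (tendsto_integral_abs_log_sub hf hz heq).const_mul C
    rw [mul_zero] at h
    rw [tendsto_iff_norm_sub_tendsto_zero]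
    refine squeeze_zero' (Eventually.of_forall fun r => norm_nonneg _) ?_ h
    filter_upwards [Ioo_mem_nhdsLT (zero_lt_one (α := ℝ))] with r hr
    have hc := continuous_log_norm_dilate hz hr.1.le hr.2
    have j1 : Integrable (fun x : UnitAddCircle =>
        herglotz z x * (Real.log ‖holo f (r * toCircle x)‖ : ℂ)) haarAddCircle :=
      integrable_of_continuous ((continuous_herglotz z).mul (continuous_ofReal.comp hc))
    have j2 : Integrable (fun x : UnitAddCircle =>
        herglotz z x * (Real.log ‖f x‖ : ℂ)) haarAddCircle :=
      hi.ofReal.bdd_mul (continuous_herglotz z).aestronglyMeasurable (Eventually.of_forall hCx)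
    rw [← integral_sub j1 j2, ← integral_const_mul]
    refine norm_integral_le_of_norm_le
      (((integrable_of_continuous hc).sub hi).abs.const_mul C) (Eventually.of_forall fun x => ?_)
    rw [← mul_sub, norm_mul, ← ofReal_sub, norm_real, Real.norm_eq_abs]
    exact mul_le_mul_of_nonneg_right (hCx x) (abs_nonneg _)
  refine tendsto_nhds_unique hlim1 ?_
  refine ((continuous_exp.tendsto _).comp hlim2).const_mul _ |>.congr' ?_
  filter_upwards [Ioo_mem_nhdsLT (zero_lt_one (α := ℝ))] with r h
  exact (hr r h.1 h.2).symm

/-! ### Density of the span implies that the function is outer -/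

theorem coeFn_fourierLp_zero :
    (fourierLp 2 0 : L2Circle) =ᵐ[haarAddCircle] fun _ => (1 : ℂ) := by
  filter_upwards [coeFn_fourierLp (T := 1) 2 0] with x hx
  rw [hx, fourier_zero]

theorem holo_zero (f : L2Circle) : holo f 0 = diskValue f 0 := holo_coe f 0

theorem diskValue_ne_zero_of_closure_eq {l : ℕ → UnitDisc} {f : L2Circle} (hf : f ∈ hardySpace)
    (h : (Submodule.span ℂ (Set.range fun n => mulCauchyKernel f (l n))).topologicalClosure
      = hardySpace) (z : UnitDisc) : diskValue f z ≠ 0 := by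
  intro hz
  have hle : Submodule.span ℂ (Set.range fun n => mulCauchyKernel f (l n)) ≤
      (innerSL ℂ (mulC (kern z) (fourierLp 2 0))).ker := by
    rw [Submodule.span_le]
    rintro _ ⟨n, rfl⟩
    simp only [SetLike.mem_coe, LinearMap.mem_ker]
    change inner ℂ (mulC (kern z) (fourierLp 2 0)) (mulCauchyKernel f (l n)) = 0
    rw [← diskValue_eq_inner, mulCauchyKernel_eq, diskValue_mulC_kern hf, hz, mul_zero]
  have hcl := Submodule.topologicalClosure_minimal _ hle
    (innerSL ℂ (mulC (kern z) (fourierLp 2 0))).isClosed_ker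
  rw [h] at hcl
  have h1 : inner ℂ (mulC (kern z) (fourierLp 2 0)) (fourierLp 2 0 : L2Circle) = 0 :=
    hcl (fourierLp_mem_hardySpace 0)
  rw [← diskValue_eq_inner, diskValue_fourierLp_zero] at h1
  exact one_ne_zero h1

/-- Induction on the span carries along multiplicativity of evaluation at 0, so no general product
theorem in H² is needed. -/
theorem exists_mulC_of_mem_span {l : ℕ → UnitDisc} {f : L2Circle} (hf : f ∈ hardySpace)
    {y : L2Circle} (hy : y ∈ Submodule.span ℂ (Set.range fun n => mulCauchyKernel f (l n))) :
    ∃ p : C(UnitAddCircle, ℂ), y = mulC p f ∧ mulC p (fourierLp 2 0) ∈ hardySpace ∧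
      diskValue y 0 = diskValue (mulC p (fourierLp 2 0)) 0 * diskValue f 0 := by
  induction hy using Submodule.span_induction with
  | mem y hy =>
    obtain ⟨n, rfl⟩ := hy
    refine ⟨kern (l n), mulCauchyKernel_eq _ _,
      mulC_kern_mem_hardySpace (fourierLp_mem_hardySpace 0) _, ?_⟩
    have h := diskValue_mulC_kern (fourierLp_mem_hardySpace 0) (l n) 0
    rw [Nat.cast_zero] at h
    dsimp only
    rw [mulCauchyKernel_eq, diskValue_mulC_kern hf, h, diskValue_fourierLp_zero, mul_one]
  | zero =>
    refine ⟨0, by simp, by simp, ?_⟩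
    simp [diskValue_eq_inner]
  | add y z _ _ hy hz =>
    obtain ⟨p, rfl, hp, hp'⟩ := hy
    obtain ⟨q, rfl, hq, hq'⟩ := hz
    refine ⟨p + q, by simp, by simpa using hardySpace.add_mem hp hq, ?_⟩
    simp only [map_add, add_apply, diskValue_add, hp', hq', add_mul]
  | smul a y _ hy =>
    obtain ⟨p, rfl, hp, hp'⟩ := hy
    refine ⟨a • p, by simp, by simpa using hardySpace.smul_mem a hp, ?_⟩
    simp only [map_smul, smul_apply, diskValue_smul, hp', mul_assoc]

/-- Jensen for `p` bounds log|p(0)| + ∫ log|f| by ∫ log|p f| ≤ ∫ |p f - 1| ≤ δ, while |p(0) f(0)| ≥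
1 - δ because a Fourier coefficient is bounded by the norm. -/
theorem integral_log_norm_le_of_norm_sub_le {f : L2Circle} (hf : f ∈ hardySpace)
    (hf0 : diskValue f 0 ≠ 0) {p : C(UnitAddCircle, ℂ)} {δ : ℝ} (hδ : δ < 1)
    (hp : mulC p (fourierLp 2 0) ∈ hardySpace)
    (hp0 : diskValue (mulC p f) 0 = diskValue (mulC p (fourierLp 2 0)) 0 * diskValue f 0)
    (hpf : ‖mulC p f - fourierLp 2 0‖ ≤ δ) :
    ∫ x, Real.log ‖f x‖ ∂haarAddCircle ≤ δ - Real.log (1 - δ) + Real.log ‖diskValue f 0‖ := by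
  obtain ⟨hne, hi, -⟩ := jensen_hardySpace hf (by rwa [holo_zero])
  set y := mulC p f with hy
  set q := mulC p (fourierLp 2 0) with hq
  have hy0 : 1 - δ ≤ ‖diskValue y 0‖ := by
    have h1 : ‖diskValue y 0 - 1‖ ≤ δ := by
      have h2 : diskValue y 0 - 1 = fourierCoeff (y - fourierLp 2 0 : L2Circle) 0 := by
        rw [fourierCoeff_sub', diskValue_zero, fourierCoeff_fourierLp, if_pos rfl]
      rw [h2]
      exact (norm_fourierCoeff_le _ _).trans hpf
    have h3 := norm_sub_norm_le (1 : ℂ) (diskValue y 0)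
    rw [norm_one, norm_sub_rev] at h3
    linarith
  have hy1 : diskValue y 0 ≠ 0 := norm_pos_iff.mp (by linarith)
  have hq0 : diskValue q 0 ≠ 0 := fun h => hy1 (by rw [hp0, h, zero_mul])
  obtain ⟨hqne, hqi, hqJ⟩ := jensen_hardySpace hp (by rwa [holo_zero])
  rw [holo_zero] at hqJ
  have hlog : Real.log ‖diskValue y 0‖ = Real.log ‖diskValue q 0‖ + Real.log ‖diskValue f 0‖ := by
    rw [hp0, norm_mul, Real.log_mul (norm_ne_zero_iff.mpr hq0) (norm_ne_zero_iff.mpr hf0)]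
  have hle : ∫ x, (Real.log ‖q x‖ + Real.log ‖f x‖) ∂haarAddCircle ≤
      ∫ x, ‖(y - fourierLp 2 0 : L2Circle) x‖ ∂haarAddCircle := by
    refine integral_mono_ae (hqi.add hi) (integrable_norm _) ?_
    filter_upwards [hne, hqne, coeFn_mulC p f, coeFn_mulC p (fourierLp 2 0), coeFn_fourierLp_zero,
      Lp.coeFn_sub y (fourierLp 2 0)] with x h1 h2 h3 h4 h5 h6
    rw [← hy] at h3
    rw [← hq, h5, mul_one] at h4
    rw [h6, Pi.sub_apply, h5, ← Real.log_mul (norm_ne_zero_iff.mpr h2) (norm_ne_zero_iff.mpr h1),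
      ← norm_mul, h4, ← h3]
    have h7 : y x ≠ 0 := by
      rw [h3, ← h4]
      exact mul_ne_zero h2 h1
    refine (Real.log_le_sub_one_of_pos (norm_pos_iff.mpr h7)).trans ?_
    simpa using norm_sub_norm_le (y x) 1
  rw [integral_add hqi hi] at hle
  have h8 := integral_norm_le_norm (y - fourierLp 2 0)
  have h9 := Real.log_le_log (by linarith) hy0
  linarith

theorem isOuter_of_closure_eq {l : ℕ → UnitDisc} {f : L2Circle} (hf : f ∈ hardySpace)
    (h : (Submodule.span ℂ (Set.range fun n => mulCauchyKernel f (l n))).topologicalClosure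
      = hardySpace) : IsOuter f := by
  have hz := diskValue_ne_zero_of_closure_eq hf h
  refine isOuter_of_integral_log_eq hf (fun z hzb => ?_) (le_antisymm ?_
    (jensen_hardySpace hf (by rw [holo_zero]; exact hz 0)).2.2)
  · rw [mem_ball_zero_iff] at hzb
    exact hz (UnitDisc.mk z hzb)
  · rw [holo_zero]
    have hlim : Tendsto (fun δ : ℝ => δ - Real.log (1 - δ) + Real.log ‖diskValue f 0‖) (𝓝[>] 0)
        (𝓝 (Real.log ‖diskValue f 0‖)) := by
      have hc : ContinuousAt (fun δ : ℝ => δ - Real.log (1 - δ) + Real.log ‖diskValue f 0‖) 0 := by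
        have : ContinuousAt (fun δ : ℝ => Real.log (1 - δ)) 0 :=
          ContinuousAt.log (by fun_prop) (by norm_num)
        fun_prop
      have h1 := hc.tendsto
      simp only [sub_zero, Real.log_one, zero_add] at h1
      exact h1.mono_left nhdsWithin_le_nhds
    refine ge_of_tendsto hlim ?_
    filter_upwards [Ioo_mem_nhdsGT (zero_lt_one (α := ℝ))] with δ hδ
    have hmem : (fourierLp 2 0 : L2Circle) ∈ closure
        (Submodule.span ℂ (Set.range fun n => mulCauchyKernel f (l n)) : Set L2Circle) := by
      rw [← Submodule.topologicalClosure_coe, h]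
      exact fourierLp_mem_hardySpace 0
    obtain ⟨y, hy, hyd⟩ := Metric.mem_closure_iff.mp hmem δ hδ.1
    obtain ⟨p, rfl, hp, hp0⟩ := exists_mulC_of_mem_span hf hy
    rw [dist_comm, dist_eq_norm] at hyd
    exact integral_log_norm_le_of_norm_sub_le hf (hz 0) hδ.2 hp hp0 hyd.le

/-! ### Blaschke condition for zeros of Cauchy transforms -/

/-- The zeros of a holomorphic function on the disc satisfy the Blaschke condition if its modulus
is dominated by that of a holomorphic function without zeros. -/
theorem summable_one_sub_norm_of_norm_le {ι : Type*} {F P : ℂ → ℂ}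
    (hF : DifferentiableOn ℂ F (Metric.ball 0 1)) (hP : DifferentiableOn ℂ P (Metric.ball 0 1))
    (hF0 : F 0 ≠ 0) (hP1 : ∀ z ∈ Metric.ball (0 : ℂ) 1, 1 ≤ ‖P z‖)
    (hFP : ∀ z ∈ Metric.ball (0 : ℂ) 1, ‖F z‖ ≤ ‖P z‖) {φ : ι → ℂ} (hφ : Function.Injective φ)
    (hφ1 : ∀ i, ‖φ i‖ < 1) (hφF : ∀ i, F (φ i) = 0) : Summable fun i => 1 - ‖φ i‖ := by
  refine summable_of_sum_le (c := Real.log ‖P 0‖ - Real.log ‖F 0‖)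
    (fun i => sub_nonneg.mpr (hφ1 i).le) fun s => ?_
  have key : ∀ᶠ r : ℝ in 𝓝[<] 1, ∑ i ∈ s, (1 - ‖φ i‖ / r) ≤ Real.log ‖P 0‖ - Real.log ‖F 0‖ := by
    have hs : ∀ᶠ r : ℝ in 𝓝[<] 1, ∀ i ∈ s, ‖φ i‖ < r := by
      rw [Filter.eventually_all_finset]
      exact fun i _ => (lt_mem_nhds (hφ1 i)).filter_mono nhdsWithin_le_nhds
    filter_upwards [hs, Ioo_mem_nhdsLT (zero_lt_one (α := ℝ))] with r hrs hr
    have hsub : Metric.closedBall (0 : ℂ) |r| ⊆ Metric.ball 0 1 := by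
      rw [abs_of_pos hr.1]
      exact Metric.closedBall_subset_ball hr.2
    have hA := hF.analyticOnNhd Metric.isOpen_ball
    have hA' := hA.mono hsub
    have hPA := (hP.analyticOnNhd Metric.isOpen_ball).mono hsub
    have hJ := hA'.circleAverage_log_norm hr.1.ne' hF0
    have hJP := AnalyticOnNhd.circleAverage_log_norm_of_ne_zero hPA fun u hu =>
      norm_pos_iff.mp (one_pos.trans_le (hP1 u (hsub hu)))
    have hle : Real.circleAverage (fun z => Real.log ‖F z‖) 0 r ≤
        Real.circleAverage (fun z => Real.log ‖P z‖) 0 r := by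
      refine Real.circleAverage_mono
        (hA'.mono Metric.sphere_subset_closedBall).meromorphicOn.circleIntegrable_log_norm
        (hPA.mono Metric.sphere_subset_closedBall).meromorphicOn.circleIntegrable_log_norm
        fun z hz => ?_
      have hzb := hsub (Metric.sphere_subset_closedBall hz)
      rcases eq_or_ne (F z) 0 with h | h
      -- As `Real.log 0 = 0`, the comparison at zeros of `F` uses |P| ≥ 1, not merely P ≠ 0.
      · rw [h, norm_zero, Real.log_zero]
        exact Real.log_nonneg (hP1 z hzb)
      · exact Real.log_le_log (norm_pos_iff.mpr h) (hFP z hzb)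
    set D := MeromorphicOn.divisor F (Metric.closedBall 0 |r|) with hD
    have hfin : (Function.support D).Finite := D.finiteSupport (isCompact_closedBall 0 |r|)
    have hnonneg (u : ℂ) : 0 ≤ (D u : ℝ) * Real.log (r * ‖0 - u‖⁻¹) := by
      by_cases hu : u ∈ Metric.closedBall (0 : ℂ) |r|
      · refine mul_nonneg ?_ ?_
        · exact_mod_cast (MeromorphicOn.AnalyticOnNhd.divisor_nonneg hA') u
        · rcases eq_or_ne u 0 with rfl | hu0
          · simp
          · refine Real.log_nonneg ?_
            rw [zero_sub, norm_neg, ← div_eq_mul_inv, one_le_div (norm_pos_iff.mpr hu0)]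
            simpa [abs_of_pos hr.1] using hu
      · simp [hD, hu]
    classical
    have hsum : ∑ᶠ u, (D u : ℝ) * Real.log (r * ‖0 - u‖⁻¹) =
        ∑ u ∈ hfin.toFinset ∪ s.map ⟨φ, hφ⟩, (D u : ℝ) * Real.log (r * ‖0 - u‖⁻¹) := by
      refine finsum_eq_sum_of_support_subset _ fun u hu => ?_
      have : D u ≠ 0 := fun h => hu (by simp [h])
      simp [this]
    -- Each φ i is a zero of multiplicity at least 1, and 1 - t ≤ log(1/t) with t = |φ i|/r.
    have h1 : ∑ i ∈ s, (1 - ‖φ i‖ / r) ≤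
        ∑ u ∈ s.map ⟨φ, hφ⟩, (D u : ℝ) * Real.log (r * ‖0 - u‖⁻¹) := by
      rw [Finset.sum_map]
      refine Finset.sum_le_sum fun i hi => ?_
      simp only [Function.Embedding.coeFn_mk, zero_sub, norm_neg]
      have hφ0 : φ i ≠ 0 := fun h => hF0 (h ▸ hφF i)
      have hmem : φ i ∈ Metric.closedBall (0 : ℂ) |r| := by
        rw [mem_closedBall_zero_iff, abs_of_pos hr.1]
        exact (hrs i hi).le
      have hord : (1 : ℤ) ≤ D (φ i) := by
        have ho1 : analyticOrderAt F (φ i) ≠ 0 :=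
          ((hA' _ hmem).analyticOrderAt_ne_zero).mpr (hφF i)
        have ho2 : analyticOrderAt F (φ i) ≠ ⊤ := by
          refine hA.analyticOrderAt_ne_top_of_isPreconnected (x := 0)
            (convex_ball (0 : ℂ) 1).isPreconnected (Metric.mem_ball_self one_pos) (hsub hmem) ?_
          rw [((hA 0 (Metric.mem_ball_self one_pos)).analyticOrderAt_eq_zero).mpr hF0]
          exact ENat.zero_ne_top
        rw [hD, MeromorphicOn.AnalyticOnNhd.divisor_apply hA' hmem]
        obtain ⟨m, hm⟩ := ENat.ne_top_iff_exists.mp ho2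
        rw [← hm] at ho1 ⊢
        have : m ≠ 0 := by
          rintro rfl
          exact ho1 rfl
        change (1 : ℤ) ≤ (m : ℤ)
        omega
      have hpos : 0 < ‖φ i‖ := norm_pos_iff.mpr hφ0
      have hlog : 1 - ‖φ i‖ / r ≤ Real.log (r * ‖φ i‖⁻¹) := by
        have := Real.log_le_sub_one_of_pos (div_pos hpos hr.1)
        rw [← div_eq_mul_inv, ← inv_div ‖φ i‖ r, Real.log_inv]
        linarith
      have h0 : 0 ≤ 1 - ‖φ i‖ / r := by
        rw [sub_nonneg, div_le_one hr.1]
        exact (hrs i hi).le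
      have hord' : (1 : ℝ) ≤ D (φ i) := by exact_mod_cast hord
      nlinarith [h0.trans hlog]
    have h2 : ∑ u ∈ s.map ⟨φ, hφ⟩, (D u : ℝ) * Real.log (r * ‖0 - u‖⁻¹) ≤
        ∑ u ∈ hfin.toFinset ∪ s.map ⟨φ, hφ⟩, (D u : ℝ) * Real.log (r * ‖0 - u‖⁻¹) :=
      Finset.sum_le_sum_of_subset_of_nonneg Finset.subset_union_right fun u _ _ => hnonneg u
    linarith
  have hlim : Tendsto (fun r : ℝ => ∑ i ∈ s, (1 - ‖φ i‖ / r)) (𝓝[<] 1)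
      (𝓝 (∑ i ∈ s, (1 - ‖φ i‖))) := by
    refine tendsto_finsetSum _ fun i _ => ?_
    have hc : ContinuousAt (fun r : ℝ => 1 - ‖φ i‖ / r) 1 :=
      continuousAt_const.sub (continuousAt_const.div continuousAt_id one_ne_zero)
    have h := hc.tendsto
    rw [div_one] at h
    exact h.mono_left nhdsWithin_le_nhds
  exact le_of_tendsto hlim key

/-- The Cauchy transform of an integrable function on the circle. -/
def cauchyTransform (h : UnitAddCircle → ℂ) (z : ℂ) : ℂ :=
  ∫ x, h x * (1 - z * toCircle x)⁻¹ ∂haarAddCircle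

theorem one_sub_mul_toCircle_ne_zero {z : ℂ} (hz : ‖z‖ < 1) (x : UnitAddCircle) :
    1 - z * (toCircle x : ℂ) ≠ 0 := by
  intro h
  have h1 : ‖z * (toCircle x : ℂ)‖ = 1 := by rw [← sub_eq_zero.mp h, norm_one]
  rw [norm_mul, Circle.norm_coe, mul_one] at h1
  exact hz.ne h1

theorem continuous_inv_one_sub_mul_toCircle {z : ℂ} (hz : ‖z‖ < 1) :
    Continuous fun x : UnitAddCircle => (1 - z * (toCircle x : ℂ))⁻¹ :=
  (continuous_const.sub (continuous_const.mul continuous_toCircle_coe)).inv₀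
    (one_sub_mul_toCircle_ne_zero hz)

theorem MeasureTheory.Integrable.mul_continuous {h k : UnitAddCircle → ℂ}
    (hh : Integrable h haarAddCircle) (hk : Continuous k) :
    Integrable (fun x => h x * k x) haarAddCircle := by
  obtain ⟨C, hC⟩ := (isCompact_range hk).isBounded.exists_norm_le
  exact hh.mul_bdd hk.aestronglyMeasurable (Eventually.of_forall fun x => hC _ ⟨x, rfl⟩)

theorem hasSum_cauchyTransform {h : UnitAddCircle → ℂ} (hh : Integrable h haarAddCircle) {z : ℂ}
    (hz : ‖z‖ < 1) : HasSum (fun n : ℕ => (∫ x, h x * fourier (n : ℤ) x ∂haarAddCircle) * z ^ n)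
      (cauchyTransform h z) := by
  have hnorm (n : ℕ) (x : UnitAddCircle) :
      ‖h x * fourier (n : ℤ) x * z ^ n‖ = ‖h x‖ * ‖z‖ ^ n := by
    rw [norm_mul, norm_mul, norm_pow, fourier_apply, Circle.norm_coe, mul_one]
  have hs := hasSum_integral_of_summable_integral_norm (μ := haarAddCircle)
    (F := fun (n : ℕ) (x : UnitAddCircle) => h x * fourier (n : ℤ) x * z ^ n)
    (fun n => (hh.mul_continuous (fourier (n : ℤ)).continuous).mul_const _) (by
      have e (n : ℕ) : ∫ x, ‖h x * fourier (n : ℤ) x * z ^ n‖ ∂haarAddCircle =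
          (∫ x, ‖h x‖ ∂haarAddCircle) * ‖z‖ ^ n := by
        rw [← integral_mul_const]
        exact integral_congr_ae (Eventually.of_forall (hnorm n))
      simp only [e]
      exact (summable_geometric_of_lt_one (norm_nonneg _) hz).mul_left _)
  have e (n : ℕ) : ∫ x, h x * fourier (n : ℤ) x * z ^ n ∂haarAddCircle =
      (∫ x, h x * fourier (n : ℤ) x ∂haarAddCircle) * z ^ n := integral_mul_const _ _
  simp only [e] at hs
  have e2 : cauchyTransform h z =
      ∫ x, ∑' n : ℕ, h x * fourier (n : ℤ) x * z ^ n ∂haarAddCircle := by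
    refine integral_congr_ae (Eventually.of_forall fun x => ?_)
    have hg := (hasSum_geometric_of_norm_lt_one (ξ := z * (toCircle x : ℂ))
      (by rwa [norm_mul, Circle.norm_coe, mul_one])).mul_left (h x)
    dsimp only
    rw [← hg.tsum_eq]
    refine tsum_congr fun n => ?_
    rw [fourier_apply, natCast_zsmul, toCircle_nsmul, mul_pow, Circle.coe_pow]
    ring
  rw [e2]
  exact hs

theorem cauchyTransform_zero (h : UnitAddCircle → ℂ) :
    cauchyTransform h 0 = ∫ x, h x ∂haarAddCircle := by
  simp [cauchyTransform]

theorem differentiableOn_cauchyTransform {h : UnitAddCircle → ℂ}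
    (hh : Integrable h haarAddCircle) :
    DifferentiableOn ℂ (cauchyTransform h) (Metric.ball 0 1) := by
  have hb (n : ℕ) : ‖∫ x, h x * fourier (n : ℤ) x ∂haarAddCircle‖ ≤
      ∫ x, ‖h x‖ ∂haarAddCircle := by
    refine (norm_integral_le_integral_norm _).trans (le_of_eq ?_)
    refine integral_congr_ae (Eventually.of_forall fun x => ?_)
    dsimp only
    rw [norm_mul, fourier_apply, Circle.norm_coe, mul_one]
  refine (differentiableOn_tsum_pow hb).congr fun z hz => ?_
  exact (hasSum_cauchyTransform hh (mem_ball_zero_iff.mp hz)).tsum_eq.symm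

/-- The map u ↦ 1/(1 - u) sends the disc to the half-plane Re > 1/2. -/
theorem half_le_re_inv_one_sub {u : ℂ} (hu : ‖u‖ < 1) : 1 / 2 ≤ ((1 - u)⁻¹).re := by
  have hne : 1 - u ≠ 0 := by
    intro h
    rw [← sub_eq_zero.mp h, norm_one] at hu
    exact lt_irrefl _ hu
  have hpos : 0 < normSq (1 - u) := normSq_pos.mpr hne
  have h2 : normSq u < 1 := by
    rw [normSq_eq_norm_sq]
    exact pow_lt_one₀ (norm_nonneg _) hu two_ne_zero
  rw [inv_re, div_le_div_iff₀ two_pos hpos]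
  simp only [normSq_apply, sub_re, one_re, sub_im, one_im] at h2 ⊢
  nlinarith

/-- The Cauchy transform of a real function that is at least `1` has real part at least `1/2`. -/
theorem half_le_norm_cauchyTransform {u : UnitAddCircle → ℝ} (hu : Integrable u haarAddCircle)
    (hu1 : ∀ x, 1 ≤ u x) {z : ℂ} (hz : ‖z‖ < 1) :
    1 / 2 ≤ ‖cauchyTransform (fun x => (u x : ℂ)) z‖ := by
  refine le_trans ?_ (re_le_norm _)
  have hi := (hu.ofReal (𝕜 := ℂ)).mul_continuous (continuous_inv_one_sub_mul_toCircle hz)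
  have hre : (cauchyTransform (fun x => (u x : ℂ)) z).re =
      ∫ x : UnitAddCircle, ((u x : ℂ) * (1 - z * toCircle x)⁻¹).re ∂haarAddCircle :=
    (integral_re hi).symm
  rw [hre]
  have hc : ∫ _ : UnitAddCircle, (1 / 2 : ℝ) ∂haarAddCircle = 1 / 2 := by simp
  rw [← hc]
  refine integral_mono (integrable_const _) hi.re fun x => ?_
  have h1 := half_le_re_inv_one_sub (u := z * toCircle x)
    (by rwa [norm_mul, Circle.norm_coe, mul_one])
  simp only [re_ofReal_mul]
  nlinarith [hu1 x]

theorem cauchyTransform_decompose {h u₁ u₂ u₃ u₄ : UnitAddCircle → ℂ}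
    (h₁ : Integrable u₁ haarAddCircle) (h₂ : Integrable u₂ haarAddCircle)
    (h₃ : Integrable u₃ haarAddCircle) (h₄ : Integrable u₄ haarAddCircle)
    (hh : ∀ x, h x = u₁ x - u₂ x + I * (u₃ x - u₄ x)) {z : ℂ} (hz : ‖z‖ < 1) :
    cauchyTransform h z = cauchyTransform u₁ z - cauchyTransform u₂ z +
      I * (cauchyTransform u₃ z - cauchyTransform u₄ z) := by
  have hc := continuous_inv_one_sub_mul_toCircle hz
  have i₁ := h₁.mul_continuous hc
  have i₂ := h₂.mul_continuous hc
  have i₃ := h₃.mul_continuous hc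
  have i₄ := h₄.mul_continuous hc
  unfold cauchyTransform
  have j₁ : Integrable (fun x : UnitAddCircle => u₁ x * (1 - z * (toCircle x : ℂ))⁻¹ -
    u₂ x * (1 - z * (toCircle x : ℂ))⁻¹) haarAddCircle := i₁.sub i₂
  have j₂ : Integrable (fun x : UnitAddCircle => I * (u₃ x * (1 - z * (toCircle x : ℂ))⁻¹ -
    u₄ x * (1 - z * (toCircle x : ℂ))⁻¹)) haarAddCircle := (i₃.sub i₄).const_mul I
  rw [← integral_sub i₁ i₂, ← integral_sub i₃ i₄, ← integral_const_mul, ← integral_add j₁ j₂]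
  refine integral_congr_ae (Eventually.of_forall fun x => ?_)
  dsimp only
  rw [hh x]
  ring

/-- Write h = u₁ - u₂ + i(u₃ - u₄) with real uⱼ ≥ 1. Their transforms Fⱼ have real part at least
1/2, so the product of the 2Fⱼ is zero-free with factors of modulus at least 1. As a + b ≤ 2ab for
a, b ≥ 1, twice this product dominates the sum of the |Fⱼ|. This replaces any Hardy space theory
below exponent 1. -/
theorem exists_norm_cauchyTransform_le {h : UnitAddCircle → ℂ} (hh : Integrable h haarAddCircle) :
    ∃ P : ℂ → ℂ, DifferentiableOn ℂ P (Metric.ball 0 1) ∧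
      (∀ z ∈ Metric.ball (0 : ℂ) 1, 1 ≤ ‖P z‖) ∧
      ∀ z ∈ Metric.ball (0 : ℂ) 1, ‖cauchyTransform h z‖ ≤ ‖P z‖ := by
  have mk (v : UnitAddCircle → ℝ) (hv : Integrable v haarAddCircle) :
      Integrable (fun x => 1 + max (v x) 0) (haarAddCircle : Measure UnitAddCircle) ∧
      ∀ x, 1 ≤ 1 + max (v x) 0 :=
    ⟨(integrable_const 1).add hv.pos_part, fun x => by linarith [le_max_right (v x) 0]⟩
  have hre : Integrable (fun x => (h x).re) (haarAddCircle : Measure UnitAddCircle) := hh.re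
  have him : Integrable (fun x => (h x).im) (haarAddCircle : Measure UnitAddCircle) := hh.im
  obtain ⟨i₁, l₁⟩ := mk _ hre
  obtain ⟨i₂, l₂⟩ := mk _ hre.neg
  obtain ⟨i₃, l₃⟩ := mk _ him
  obtain ⟨i₄, l₄⟩ := mk _ him.neg
  have hdec (x) : h x = ((1 + max (h x).re 0 : ℝ) : ℂ) - ((1 + max (-(h x).re) 0 : ℝ) : ℂ) +
      I * (((1 + max (h x).im 0 : ℝ) : ℂ) - ((1 + max (-(h x).im) 0 : ℝ) : ℂ)) := by
    have hm (t : ℝ) : max t 0 - max (-t) 0 = t := by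
      rcases le_total t 0 with ht | ht
      · rw [max_eq_right ht, max_eq_left (by linarith)]
        ring
      · rw [max_eq_left ht, max_eq_right (by linarith)]
        ring
    rw [← ofReal_sub, ← ofReal_sub, add_sub_add_left_eq_sub, add_sub_add_left_eq_sub, hm, hm,
      mul_comm, re_add_im]
  set F₁ := cauchyTransform fun x => ((1 + max (h x).re 0 : ℝ) : ℂ)
  set F₂ := cauchyTransform fun x => ((1 + max (-(h x).re) 0 : ℝ) : ℂ)
  set F₃ := cauchyTransform fun x => ((1 + max (h x).im 0 : ℝ) : ℂ)
  set F₄ := cauchyTransform fun x => ((1 + max (-(h x).im) 0 : ℝ) : ℂ)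
  have d₁ : DifferentiableOn ℂ F₁ (Metric.ball 0 1) := differentiableOn_cauchyTransform i₁.ofReal
  have d₂ : DifferentiableOn ℂ F₂ (Metric.ball 0 1) := differentiableOn_cauchyTransform i₂.ofReal
  have d₃ : DifferentiableOn ℂ F₃ (Metric.ball 0 1) := differentiableOn_cauchyTransform i₃.ofReal
  have d₄ : DifferentiableOn ℂ F₄ (Metric.ball 0 1) := differentiableOn_cauchyTransform i₄.ofReal
  have bound (z : ℂ) (hz : z ∈ Metric.ball (0 : ℂ) 1) : 1 ≤ 2 * ‖F₁ z‖ ∧ 1 ≤ 2 * ‖F₂ z‖ ∧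
      1 ≤ 2 * ‖F₃ z‖ ∧ 1 ≤ 2 * ‖F₄ z‖ := by
    rw [mem_ball_zero_iff] at hz
    have b₁ : 1 / 2 ≤ ‖F₁ z‖ := half_le_norm_cauchyTransform i₁ l₁ hz
    have b₂ : 1 / 2 ≤ ‖F₂ z‖ := half_le_norm_cauchyTransform i₂ l₂ hz
    have b₃ : 1 / 2 ≤ ‖F₃ z‖ := half_le_norm_cauchyTransform i₃ l₃ hz
    have b₄ : 1 / 2 ≤ ‖F₄ z‖ := half_le_norm_cauchyTransform i₄ l₄ hz
    refine ⟨?_, ?_, ?_, ?_⟩ <;> linarith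
  have hnormP (z : ℂ) : ‖2 * ((2 * F₁ z) * (2 * F₂ z) * ((2 * F₃ z) * (2 * F₄ z)))‖ =
      2 * ((2 * ‖F₁ z‖) * (2 * ‖F₂ z‖) * ((2 * ‖F₃ z‖) * (2 * ‖F₄ z‖))) := by
    simp only [norm_mul, RCLike.norm_ofNat]
  refine ⟨fun z => 2 * ((2 * F₁ z) * (2 * F₂ z) * ((2 * F₃ z) * (2 * F₄ z))),
    (((d₁.const_mul 2).mul (d₂.const_mul 2)).mul
      ((d₃.const_mul 2).mul (d₄.const_mul 2))).const_mul 2, fun z hz => ?_, fun z hz => ?_⟩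
  · obtain ⟨b₁, b₂, b₃, b₄⟩ := bound z hz
    rw [hnormP]
    have h12 := one_le_mul_of_one_le_of_one_le b₁ b₂
    have h34 := one_le_mul_of_one_le_of_one_le b₃ b₄
    linarith [one_le_mul_of_one_le_of_one_le h12 h34]
  · obtain ⟨b₁, b₂, b₃, b₄⟩ := bound z hz
    rw [hnormP, cauchyTransform_decompose i₁.ofReal i₂.ofReal i₃.ofReal i₄.ofReal hdec
      (mem_ball_zero_iff.mp hz)]
    have t : ‖F₁ z - F₂ z + I * (F₃ z - F₄ z)‖ ≤ ‖F₁ z‖ + ‖F₂ z‖ + (‖F₃ z‖ + ‖F₄ z‖) := by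
      refine (norm_add_le _ _).trans (add_le_add (norm_sub_le _ _) ?_)
      rw [norm_mul, norm_I, one_mul]
      exact norm_sub_le _ _
    refine t.trans ?_
    have key (a b : ℝ) (ha : 1 ≤ a) (hb : 1 ≤ b) : a + b ≤ 2 * (a * b) := by nlinarith
    have h12 := one_le_mul_of_one_le_of_one_le b₁ b₂
    have h34 := one_le_mul_of_one_le_of_one_le b₃ b₄
    linarith [key _ _ b₁ b₂, key _ _ b₃ b₄, key _ _ h12 h34]

/-- If the Cauchy transform of an integrable function vanishes on the conjugates of a set that
violates the Blaschke condition, then all its Taylor coefficients vanish. -/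
theorem integral_mul_fourier_eq_zero {S : Set UnitDisc}
    (hS : ¬ Summable fun w : S => 1 - ‖((w : UnitDisc) : ℂ)‖) {h : UnitAddCircle → ℂ}
    (hh : Integrable h haarAddCircle)
    (hz : ∀ w ∈ S, cauchyTransform h (conj (w : ℂ)) = 0) (n : ℕ) :
    ∫ x, h x * fourier (n : ℤ) x ∂haarAddCircle = 0 := by
  by_contra hn
  classical
  have hex : ∃ n : ℕ, ∫ x, h x * fourier (n : ℤ) x ∂haarAddCircle ≠ 0 := ⟨n, hn⟩
  -- Dividing by zᵏ, with k the order of vanishing at the origin, meets the requirement of a nonzero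
  -- value at 0 in Jensen's formula.
  set k := Nat.find hex with hk
  have hk0 : ∫ x, h x * fourier (k : ℤ) x ∂haarAddCircle ≠ 0 := Nat.find_spec hex
  have hlt (m : ℕ) (hm : m < k) : ∫ x, h x * fourier (m : ℤ) x ∂haarAddCircle = 0 :=
    not_not.mp (Nat.find_min hex hm)
  set h' : UnitAddCircle → ℂ := fun x => h x * fourier (k : ℤ) x with hh'
  have hh'i : Integrable h' haarAddCircle := hh.mul_continuous (fourier (k : ℤ)).continuous
  have hshift (z : ℂ) (hz1 : ‖z‖ < 1) :
      cauchyTransform h z = z ^ k * cauchyTransform h' z := by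
    refine (hasSum_cauchyTransform hh hz1).unique ?_
    refine (Function.Injective.hasSum_iff (g := fun m : ℕ => m + k)
      (add_left_injective k) ?_).mp ?_
    · intro m hm
      rw [hlt m ?_, zero_mul]
      by_contra h0
      exact hm ⟨m - k, by simp; omega⟩
    · refine ((hasSum_cauchyTransform hh'i hz1).mul_left (z ^ k)).congr_eq fun m => ?_
      have e : ∫ x, h' x * fourier (m : ℤ) x ∂haarAddCircle =
          ∫ x, h x * fourier ((m + k : ℕ) : ℤ) x ∂haarAddCircle := by
        refine integral_congr_ae (Eventually.of_forall fun x => ?_)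
        simp only [hh', Nat.cast_add, fourier_add]
        ring
      rw [e, Function.comp_apply, pow_add]
      ring
  obtain ⟨P, hPd, hP1, hFP⟩ := exists_norm_cauchyTransform_le hh'i
  -- The origin is removed because zᵏ may account for a zero there; a single term does not affect
  -- summability.
  have hsum := summable_one_sub_norm_of_norm_le (ι := ↥(S \ {0}))
    (differentiableOn_cauchyTransform hh'i) hPd (by rwa [cauchyTransform_zero]) hP1 hFP
    (φ := fun w => conj ((w : UnitDisc) : ℂ))
    (fun a b hab => Subtype.ext (UnitDisc.coe_injective ((starRingEnd ℂ).injective hab)))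
    (fun w => by simpa using (w : UnitDisc).norm_lt_one) (fun w => by
      have h1 := hz w w.2.1
      rw [hshift _ (by simpa using (w : UnitDisc).norm_lt_one)] at h1
      refine (mul_eq_zero.mp h1).resolve_left (pow_ne_zero _ ?_)
      rw [Ne, map_eq_zero, UnitDisc.coe_eq_zero]
      exact w.2.2)
  simp only [RCLike.norm_conj] at hsum
  refine hS ?_
  have e1 := (summable_subtype_iff_indicator (f := fun w : UnitDisc => 1 - ‖(w : ℂ)‖)
    (s := S \ {0})).mp hsum
  refine (summable_subtype_iff_indicator (f := fun w : UnitDisc => 1 - ‖(w : ℂ)‖)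
    (s := S)).mpr (e1.congr_cofinite ?_)
  refine (Set.finite_singleton (0 : UnitDisc)).subset fun w hw => ?_
  by_contra hw0
  refine hw ?_
  change (S \ {0}).indicator _ w = S.indicator _ w
  by_cases hwS : w ∈ S
  · rw [Set.indicator_of_mem hwS, Set.indicator_of_mem (show w ∈ S \ {0} from ⟨hwS, hw0⟩)]
  · rw [Set.indicator_of_notMem hwS,
      Set.indicator_of_notMem (show w ∉ S \ {0} from fun h => hwS h.1)]

/-- The inner products of `g` with f k_w and zⁿ f are the values at conj w and the Taylor
coefficients of the Cauchy transform of `conj g * f`, which is only in L¹. -/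
theorem inner_mulC_fourier_eq_zero {l : ℕ → UnitDisc}
    (hl : ¬ Summable fun w : Set.range l => 1 - ‖((w : UnitDisc) : ℂ)‖) {f g : L2Circle}
    (hg : ∀ n, inner ℂ g (mulCauchyKernel f (l n)) = 0) (n : ℕ) :
    inner ℂ g (mulC (fourier n) f) = 0 := by
  have e (p : C(UnitAddCircle, ℂ)) : inner ℂ g (mulC p f) =
      ∫ x, conj (g x) * f x * p x ∂haarAddCircle := by
    rw [inner_eq_integral]
    refine integral_congr_ae ?_
    filter_upwards [coeFn_mulC p f] with x hx
    rw [hx]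
    ring
  rw [e]
  refine integral_mul_fourier_eq_zero hl (integrable_conj_mul g f) ?_ n
  rintro _ ⟨m, rfl⟩
  rw [← hg m, mulCauchyKernel_eq, e]
  refine integral_congr_ae (Eventually.of_forall fun x => ?_)
  simp [kern, cauchyKernel]

/-! ### Vectors of constant modulus -/

/-- A nonnegative integrable function on the circle whose Fourier coefficients of nonzero index
vanish is constant. -/
theorem ae_eq_const_of_integral_fourier_eq_zero {w : UnitAddCircle → ℝ} (hw0 : ∀ x, 0 ≤ w x)
    (hw : Integrable w haarAddCircle)
    (h : ∀ k : ℤ, k ≠ 0 → ∫ x, (w x : ℂ) * fourier k x ∂haarAddCircle = 0) :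
    w =ᵐ[haarAddCircle] fun _ => ∫ x, w x ∂haarAddCircle := by
  set c : ℝ := ∫ x, w x ∂haarAddCircle with hc
  have hc0 : 0 ≤ c := integral_nonneg hw0
  have hm : AEMeasurable (fun x => ENNReal.ofReal (w x)) haarAddCircle :=
    hw.aemeasurable.ennreal_ofReal
  have hfin : ∫⁻ x, ENNReal.ofReal (w x) ∂haarAddCircle ≠ ∞ := by
    rw [← ofReal_integral_eq_lintegral_ofReal hw (Eventually.of_forall hw0)]
    exact ENNReal.ofReal_ne_top
  have : IsFiniteMeasure ((haarAddCircle : Measure UnitAddCircle).withDensity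
    fun x => ENNReal.ofReal (w x)) := isFiniteMeasure_withDensity hfin
  have : IsFiniteMeasure ((haarAddCircle : Measure UnitAddCircle).withDensity
    fun _ => ENNReal.ofReal c) := isFiniteMeasure_withDensity (by simp)
  -- As `w` is only integrable, Parseval is unavailable; instead both densities define finite
  -- measures agreeing on trigonometric polynomials, a star subalgebra separating points.
  have key : (haarAddCircle : Measure UnitAddCircle).withDensity (fun x => ENNReal.ofReal (w x)) =
      haarAddCircle.withDensity fun _ => ENNReal.ofReal c := by
    refine ext_of_forall_mem_subalgebra_integral_eq_of_pseudoEMetric_complete_countable (𝕜 := ℂ)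
      (A := (fourierSubalgebra (T := 1)).comap
        (BoundedContinuousFunction.toContinuousMapStarₐ ℂ)) ?_ fun g hg => ?_
    · intro x y hxy
      obtain ⟨_, ⟨p, hp, rfl⟩, hne⟩ := fourierSubalgebra_separatesPoints hxy
      exact ⟨_, ⟨p, ⟨BoundedContinuousFunction.mkOfCompact p, hp, rfl⟩, rfl⟩, hne⟩
    · have hg' : (g : C(UnitAddCircle, ℂ)) ∈ Submodule.span ℂ (Set.range (fourier (T := 1))) := by
        rw [← fourierSubalgebra_coe]
        exact hg
      change ∫ x, (g : C(UnitAddCircle, ℂ)) x ∂_ = ∫ x, (g : C(UnitAddCircle, ℂ)) x ∂_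
      rw [integral_withDensity_eq_integral_toReal_smul₀ hm
        (Eventually.of_forall fun _ => ENNReal.ofReal_lt_top),
        integral_withDensity_eq_integral_toReal_smul₀ aemeasurable_const
        (Eventually.of_forall fun _ => ENNReal.ofReal_lt_top)]
      simp only [ENNReal.toReal_ofReal (hw0 _), ENNReal.toReal_ofReal hc0, real_smul]
      generalize (g : C(UnitAddCircle, ℂ)) = p at hg'
      have hi (p : C(UnitAddCircle, ℂ)) : Integrable (fun x => (w x : ℂ) * p x) haarAddCircle :=
        (hw.ofReal (𝕜 := ℂ)).mul_continuous p.continuous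
      have hi' (p : C(UnitAddCircle, ℂ)) : Integrable (fun x => (c : ℂ) * p x) haarAddCircle :=
        (integrable_of_continuous p.continuous).const_mul _
      induction hg' using Submodule.span_induction with
      | mem p hp =>
        obtain ⟨k, rfl⟩ := hp
        rw [integral_const_mul]
        have hk : ∫ x, fourier k x ∂(haarAddCircle : Measure UnitAddCircle) =
            if k = 0 then 1 else 0 := by
          have h1 := fourierCoeff_fourierLp k 0
          rw [fourierCoeff_congr_ae (coeFn_fourierLp 2 k)] at h1
          simpa [fourierCoeff, eq_comm] using h1
        rcases eq_or_ne k 0 with rfl | hk0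
        · rw [hk, if_pos rfl, mul_one]
          simp only [fourier_zero, mul_one]
          exact integral_ofReal
        · rw [h k hk0, hk, if_neg hk0, mul_zero]
      | zero => simp
      | add p q _ _ hp hq =>
        simp only [ContinuousMap.add_apply, mul_add]
        rw [integral_add (hi p) (hi q), integral_add (hi' p) (hi' q), hp, hq]
      | smul a p _ hp =>
        simp only [ContinuousMap.smul_apply, smul_eq_mul, mul_left_comm _ a]
        rw [integral_const_mul, integral_const_mul, hp]
  rw [withDensity_eq_iff hm aemeasurable_const hfin] at key
  filter_upwards [key] with x hx
  exact (ENNReal.ofReal_eq_ofReal_iff (hw0 x) hc0).mp hx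

theorem IsOuter.norm_diskValue_zero {f : L2Circle} (hf : IsOuter f) :
    ‖diskValue f 0‖ = Real.exp (∫ x, Real.log ‖f x‖ ∂haarAddCircle) := by
  obtain ⟨-, -, -, c, hc, h⟩ := hf
  have e : ∫ x : UnitAddCircle, ((toCircle x : ℂ) + ((0 : UnitDisc) : ℂ)) /
      ((toCircle x : ℂ) - ((0 : UnitDisc) : ℂ)) * (Real.log ‖f x‖ : ℂ) ∂haarAddCircle =
      ((∫ x, Real.log ‖f x‖ ∂haarAddCircle : ℝ) : ℂ) := by
    rw [← integral_complex_ofReal]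
    refine integral_congr_ae (Eventually.of_forall fun x => ?_)
    simp
  rw [h 0, e, norm_mul, hc, one_mul, norm_exp, ofReal_re]

theorem inner_self_eq_integral_sq (v : L2Circle) :
    ‖v‖ ^ 2 = ∫ x, ‖v x‖ ^ 2 ∂haarAddCircle := by
  have h := inner_self_eq_norm_sq_to_K (𝕜 := ℂ) v
  rw [inner_eq_integral] at h
  have e : ∫ x, conj (v x) * v x ∂haarAddCircle =
      ((∫ x, ‖v x‖ ^ 2 ∂haarAddCircle : ℝ) : ℂ) := by
    rw [← integral_complex_ofReal]
    refine integral_congr_ae (Eventually.of_forall fun x => ?_)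
    dsimp only
    rw [conj_mul', ofReal_pow]
  rw [e] at h
  refine ofReal_injective ?_
  rw [ofReal_pow]
  exact h.symm

/-- A wandering vector of the shift has constant modulus. -/
theorem norm_sq_ae_eq_of_inner_eq_zero {v : L2Circle}
    (hv : ∀ n : ℕ, inner ℂ v (mulC (fourier ((n + 1 : ℕ) : ℤ)) v) = 0) :
    ∀ᵐ x ∂(haarAddCircle : Measure UnitAddCircle), ‖v x‖ ^ 2 = ‖v‖ ^ 2 := by
  have hi : Integrable (fun x => ‖v x‖ ^ 2) (haarAddCircle : Measure UnitAddCircle) :=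
    (memLp_two_iff_integrable_sq_norm (Lp.aestronglyMeasurable v)).mp (Lp.memLp v)
  have e (k : ℤ) : ∫ x, ((‖v x‖ ^ 2 : ℝ) : ℂ) * fourier k x ∂haarAddCircle =
      inner ℂ v (mulC (fourier k) v) := by
    rw [inner_eq_integral]
    refine integral_congr_ae ?_
    filter_upwards [coeFn_mulC (fourier k) v] with x hx
    rw [hx, ofReal_pow, ← conj_mul']
    ring
  have h := ae_eq_const_of_integral_fourier_eq_zero (fun x => sq_nonneg ‖v x‖) hi fun k hk => by
    rw [e]
    rcases lt_or_gt_of_ne hk with h | h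
    -- Negative frequencies reduce to positive ones by conjugate symmetry.
    · have h1 := hv (-k - 1).toNat
      rw [show (((-k - 1).toNat + 1 : ℕ) : ℤ) = -k by omega] at h1
      rw [← inner_conj_symm, inner_mulC_fourier, h1, map_zero]
    · have h1 := hv (k - 1).toNat
      rwa [show (((k - 1).toNat + 1 : ℕ) : ℤ) = k by omega] at h1
  rw [← inner_self_eq_integral_sq] at h
  exact h

/-! ### Outer functions are cyclic -/

/-- The closed span of `z f, z² f, …`. -/
def shiftSpan (f : L2Circle) : Submodule ℂ L2Circle :=
  (Submodule.span ℂ (Set.range fun n : ℕ =>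
    mulC (fourier ((n + 1 : ℕ) : ℤ)) f)).topologicalClosure

theorem isClosed_shiftSpan (f : L2Circle) : IsClosed (shiftSpan f : Set L2Circle) :=
  Submodule.isClosed_topologicalClosure _

theorem mulC_fourier_mem_shiftSpan (f : L2Circle) {n : ℕ} (hn : n ≠ 0) :
    mulC (fourier (n : ℤ)) f ∈ shiftSpan f := by
  obtain ⟨m, rfl⟩ := Nat.exists_eq_succ_of_ne_zero hn
  exact Submodule.le_topologicalClosure _ (Submodule.subset_span ⟨m, rfl⟩)

theorem shiftSpan_le {f : L2Circle} {K : Submodule ℂ L2Circle} (hK : IsClosed (K : Set L2Circle))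
    (h : ∀ n : ℕ, n ≠ 0 → mulC (fourier (n : ℤ)) f ∈ K) : shiftSpan f ≤ K := by
  refine Submodule.topologicalClosure_minimal _ (Submodule.span_le.mpr ?_) hK
  rintro _ ⟨n, rfl⟩
  exact h _ n.succ_ne_zero

theorem mulC_fourier_mem_shiftSpan_of_mem {f m : L2Circle} (hm : m ∈ shiftSpan f) (n : ℕ) :
    mulC (fourier (n : ℤ)) m ∈ shiftSpan f := by
  have h : shiftSpan f ≤ (shiftSpan f).comap (mulC (fourier (n : ℤ))).toLinearMap := by
    refine shiftSpan_le ?_ fun k hk => ?_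
    · rw [Submodule.comap_coe]
      exact (isClosed_shiftSpan f).preimage (mulC (fourier (n : ℤ))).continuous
    · rw [Submodule.mem_comap, ContinuousLinearMap.coe_coe, mulC_fourier_fourier, ← Nat.cast_add]
      exact mulC_fourier_mem_shiftSpan f (by omega)
  exact Submodule.mem_comap.mp (h hm)

theorem fourierCoeff_zero_of_mem_shiftSpan {f m : L2Circle} (hf : f ∈ hardySpace)
    (hm : m ∈ shiftSpan f) : fourierCoeff m 0 = 0 := by
  have h : shiftSpan f ≤ (innerSL ℂ (fourierLp 2 0 : L2Circle)).ker :=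
    shiftSpan_le (innerSL ℂ (fourierLp 2 0 : L2Circle)).isClosed_ker fun n hn => by
      change inner ℂ (fourierLp 2 0 : L2Circle) (mulC (fourier (n : ℤ)) f) = 0
      rw [← fourierCoeff_eq_inner, fourierCoeff_mulC_fourier]
      exact hf _ (by omega)
  rw [fourierCoeff_eq_inner]
  exact h hm

/-- If `f` is outer, then the component of `f` orthogonal to `z f, z² f, …` is a constant. -/
theorem eq_smul_fourierLp_of_isOuter {f m v : L2Circle} (hf : IsOuter f) (hm : m ∈ shiftSpan f)
    (hv : v ∈ (shiftSpan f)ᗮ) (hfv : f = m + v) :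
    fourierCoeff v 0 ≠ 0 ∧ v = fourierCoeff v 0 • (fourierLp 2 0 : L2Circle) := by
  have hvm (u : L2Circle) (hu : u ∈ shiftSpan f) : inner ℂ v u = 0 :=
    Submodule.inner_left_of_mem_orthogonal hu hv
  have hv0 : fourierCoeff v 0 = diskValue f 0 := by
    have h : v = f - m := by rw [hfv, add_sub_cancel_left]
    rw [h, fourierCoeff_sub', fourierCoeff_zero_of_mem_shiftSpan hf.1 hm, sub_zero, diskValue_zero]
  have hne0 : fourierCoeff v 0 ≠ 0 := by
    rw [hv0, ← norm_ne_zero_iff, hf.norm_diskValue_zero]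
    exact (Real.exp_pos _).ne'
  have hvne : v ≠ 0 := by
    rintro rfl
    rw [fourierCoeff_eq_inner, inner_zero_right] at hne0
    exact hne0 rfl
  -- Here zⁿ⁺¹ v = zⁿ⁺¹ f - zⁿ⁺¹ m lies in the shift span, to which `v` is orthogonal.
  have hwand (n : ℕ) : inner ℂ v (mulC (fourier ((n + 1 : ℕ) : ℤ)) v) = 0 := by
    have h : mulC (fourier ((n + 1 : ℕ) : ℤ)) v = mulC (fourier ((n + 1 : ℕ) : ℤ)) f -
        mulC (fourier ((n + 1 : ℕ) : ℤ)) m := by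
      rw [← map_sub, hfv, add_sub_cancel_left]
    rw [h]
    exact hvm _ (sub_mem (mulC_fourier_mem_shiftSpan f n.succ_ne_zero)
      (mulC_fourier_mem_shiftSpan_of_mem hm _))
  have hmod := norm_sq_ae_eq_of_inner_eq_zero hwand
  set c : ℝ := ‖v‖ ^ 2 with hc
  have hcpos : 0 < c := by positivity
  -- Since |v|² = c, this function is the quotient f / v. Orthogonality of `v` to zⁿ f for n ≥ 1
  -- kills its negative coefficients.
  have hh : MemLp (fun x => f x * (conj (v x) / c)) 2 (haarAddCircle : Measure UnitAddCircle) := by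
    have hk : MemLp (fun x => conj (v x) / (c : ℂ)) ∞ (haarAddCircle : Measure UnitAddCircle) := by
      refine memLp_top_of_bound (C := Real.sqrt c / c) ?_ ?_
      · exact ((continuous_conj.measurable.comp
          (Lp.stronglyMeasurable v).measurable).div_const _).aestronglyMeasurable
      · filter_upwards [hmod] with x hx
        rw [norm_div, RCLike.norm_conj, norm_real, Real.norm_of_nonneg hcpos.le, ← hx,
          Real.sqrt_sq (norm_nonneg _)]
    exact hk.mul (Lp.memLp f)
  set h := hh.toLp with hhdef
  have hhx : h =ᵐ[haarAddCircle] fun x => f x * (conj (v x) / c) := hh.coeFn_toLp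
  have hcoeff (n : ℤ) : fourierCoeff h n = (c : ℂ)⁻¹ * inner ℂ v (mulC (fourier (-n)) f) := by
    rw [inner_eq_integral, ← integral_const_mul]
    refine integral_congr_ae ?_
    filter_upwards [hhx, coeFn_mulC (fourier (-n)) f] with x h1 h2
    rw [h1, h2, smul_eq_mul]
    ring
  have hH : h ∈ hardySpace := by
    intro n hn
    have h1 := mulC_fourier_mem_shiftSpan f (n := (-n).toNat) (by omega)
    rw [Int.toNat_of_nonneg (by omega)] at h1
    rw [hcoeff, hvm _ h1, mul_zero]
  have hh0 : holo h 0 = 1 := by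
    rw [holo_zero, diskValue_zero, hcoeff, neg_zero, mulC_fourier_zero, hfv, inner_add_right,
      hvm m hm, zero_add, inner_self_eq_norm_sq_to_K, inv_mul_eq_one₀ (by exact_mod_cast hcpos.ne')]
    rw [hc]
    push_cast
    rfl
  obtain ⟨-, -, hJ⟩ := jensen_hardySpace hH (by rw [hh0]; exact one_ne_zero)
  rw [hh0, norm_one, Real.log_one] at hJ
  have hlog : ∫ x, Real.log ‖h x‖ ∂haarAddCircle =
      ∫ x, Real.log ‖f x‖ ∂haarAddCircle - Real.log c / 2 := by
    have h1 : ∫ x, Real.log ‖h x‖ ∂haarAddCircle =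
        ∫ x, (Real.log ‖f x‖ - Real.log c / 2) ∂haarAddCircle := by
      refine integral_congr_ae ?_
      filter_upwards [hhx, hmod, hf.2.1] with x h1 h2 h3
      have h4 : ‖v x‖ ≠ 0 := by
        intro h
        rw [h] at h2
        exact hcpos.ne (by simpa using h2)
      have h5 : Real.log c = 2 * Real.log ‖v x‖ := by
        rw [← h2, Real.log_pow]
        norm_num
      rw [h1, norm_mul, norm_div, RCLike.norm_conj, norm_real, Real.norm_of_nonneg hcpos.le,
        Real.log_mul (norm_ne_zero_iff.mpr h3) (div_ne_zero h4 hcpos.ne'),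
        Real.log_div h4 hcpos.ne', h5]
      ring
    rw [h1, integral_sub hf.2.2.1 (integrable_const _)]
    simp
  -- Jensen for `h` reads 0 ≤ ∫ log|f| - (log c)/2, and v̂(0) = f(0) has modulus exp ∫ log|f|. So
  -- the constant coefficient carries the full norm of `v`.
  have hle : c ≤ ‖fourierCoeff v 0‖ ^ 2 := by
    rw [hv0, hf.norm_diskValue_zero, ← Real.exp_nat_mul, ← Real.log_le_iff_le_exp hcpos]
    push_cast
    linarith
  refine ⟨hne0, ?_⟩
  have hz : ‖v - fourierCoeff v 0 • (fourierLp 2 0 : L2Circle)‖ ^ 2 =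
      c - ‖fourierCoeff v 0‖ ^ 2 := by
    rw [norm_sub_sq (𝕜 := ℂ), inner_smul_right, ← inner_conj_symm, ← fourierCoeff_eq_inner,
      mul_conj', norm_smul, norm_fourierLp_two, ← ofReal_pow, RCLike.re_to_complex, ofReal_re]
    ring
  rw [← sub_eq_zero, ← norm_eq_zero, ← sq_eq_zero_iff]
  exact le_antisymm (by linarith) (sq_nonneg _)

theorem hardySpace_le_closure_of_isOuter {l : ℕ → UnitDisc}
    (hl : ¬ Summable fun w : Set.range l => 1 - ‖((w : UnitDisc) : ℂ)‖) {f : L2Circle}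
    (hf : IsOuter f) : hardySpace ≤
      (Submodule.span ℂ (Set.range fun n => mulCauchyKernel f (l n))).topologicalClosure := by
  set K := Submodule.span ℂ (Set.range fun n => mulCauchyKernel f (l n)) with hK
  have hclosed : IsClosed (K.topologicalClosure : Set L2Circle) :=
    Submodule.isClosed_topologicalClosure _
  have hz (n : ℕ) : mulC (fourier (n : ℤ)) f ∈ K.topologicalClosure := by
    rw [← Submodule.orthogonal_orthogonal_eq_closure]
    intro g hg
    exact inner_mulC_fourier_eq_zero hl (fun m => Submodule.inner_left_of_mem_orthogonal
      (Submodule.subset_span (Set.mem_range_self m)) hg) n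
  have hS : shiftSpan f ≤ K.topologicalClosure := shiftSpan_le hclosed fun n _ => hz n
  have : CompleteSpace (shiftSpan f) := (isClosed_shiftSpan f).completeSpace_coe
  obtain ⟨m, hm, v, hv, hfv⟩ := (shiftSpan f).exists_add_mem_mem_orthogonal f
  obtain ⟨hne, hconst⟩ := eq_smul_fourierLp_of_isOuter hf hm hv hfv
  -- As `v` is a nonzero constant, zⁿ v is a nonzero multiple of the monomial zⁿ.
  have he (n : ℕ) : (fourierLp 2 (n : ℤ) : L2Circle) ∈ K.topologicalClosure := by
    have h1 : mulC (fourier (n : ℤ)) v = mulC (fourier (n : ℤ)) f - mulC (fourier (n : ℤ)) m := by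
      rw [← map_sub, hfv, add_sub_cancel_left]
    have h2 : mulC (fourier (n : ℤ)) v ∈ K.topologicalClosure := by
      rw [h1]
      exact sub_mem (hz n) (hS (mulC_fourier_mem_shiftSpan_of_mem hm n))
    rw [hconst, map_smul, mulC_fourier_fourierLp, add_zero] at h2
    exact (Submodule.smul_mem_iff _ hne).mp h2
  intro g hg
  exact hclosed.mem_of_tendsto (hasSum_fourier_of_mem_hardySpace hg)
    (Eventually.of_forall fun _ => Submodule.sum_mem _ fun n _ => Submodule.smul_mem _ _ (he n))

theorem closure_le_hardySpace (l : ℕ → UnitDisc) {f : L2Circle} (hf : f ∈ hardySpace) :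
    (Submodule.span ℂ (Set.range fun n => mulCauchyKernel f (l n))).topologicalClosure ≤
      hardySpace := by
  refine Submodule.topologicalClosure_minimal _ (Submodule.span_le.mpr ?_) isClosed_hardySpace
  rintro _ ⟨n, rfl⟩
  dsimp only
  rw [mulCauchyKernel_eq]
  exact mulC_kern_mem_hardySpace hf _

end

/-- Let `l` be a sequence in the unit disc whose distinct terms `w` satisfy `∑ (1 - |w|) = ∞`, and
let `f ∈ H²`. The closed linear span (taken in `L²(𝕋)`, of which `H²` is a closed subspace) of the
family `f k_{l n}` is all of `H²` if and only if `f` is outer. -/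
theorem mainTheorem8 (l : ℕ → UnitDisc)
    (hl : ¬ Summable fun w : Set.range l => 1 - ‖((w : UnitDisc) : ℂ)‖)
    (f : L2Circle) (hf : f ∈ hardySpace) :
    (Submodule.span ℂ (Set.range fun n => mulCauchyKernel f (l n))).topologicalClosure
      = hardySpace ↔ IsOuter f :=
  ⟨fun h => isOuter_of_closure_eq hf h, fun h =>
    le_antisymm (closure_le_hardySpace l hf) (hardySpace_le_closure_of_isOuter hl h)⟩
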